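/- Let $(\mathbb M,\rho)$ be a compact metric space of diameter $\pi$, and let $h:\mathbb R\to[0,\infty)$ be an even $C^\infty$ function with $h(u)=1$ for $|u|\le 1/2$ and $h(u)=0$ for $|u|\ge 1$. For $n\ge1$ put $\Phi_n(t)=\sum_{|k|<n}h(k/n)e^{ikt}$ and $\Psi_n(x,y)=\Phi_n(\rho(x,y))^2$. Given points $x_1,\dots,x_M\in\mathbb M$ and $\Theta>0$, put $$F_n(x)=\frac1M\sum_{j=1}^M\Psi_n(x,x_j),\qquad \mathcal G_n(\Theta)=\Big\{x\in\mathbb M: F_n(x)\ge\Theta\max_{1\le k\le M}F_n(x_k)\Big\}.$$ For $A\subseteq\mathbb M$ write $\mathbb B(A,\delta)=\{x:\operatorname{dist}(x,A)\le\delta\}$ and $\mathbb B(x,\delta)=\mathbb B(\{x\},\delta)$, with $\inf\emptyset=\infty$; sets of a partition may be empty. A Borel probability measure $\mu$ on $\mathbb M$ with support $\mathbb X$ is *detectable* with parameters $\alpha\ge0$, $\kappa_1,\kappa_2,r_0>0$ if $\mu(\mathbb B(x,r))\le\kappa_1r^\alpha$ for all $x\in\mathbb M$, $r>0$, and $\mu(\mathbb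 B(x,r))\ge\kappa_2r^\alpha$ for all $x\in\mathbb X$, $0<r\le r_0$. A *fine structure* of $\mu$ consists of $\eta_0>0$ and, for every $\eta\in(0,\eta_0]$, a number $K_\eta$ and a partition of $\mathbb X$ into Borel sets $\mathbf S_{1,\eta},\dots,\mathbf S_{K_\eta+1,\eta}$ such that $\operatorname{dist}(\mathbf S_{j,\eta},\mathbf S_{k,\eta})\ge2\eta$ for all $j\ne k$ in $\{1,\dots,K_\eta\}$, and $\mu(\mathbf S_{K_\eta+1,\eta})\to0$ as $\eta\to0^+$. For sets $\mathcal C_1,\dots,\mathcal C_N$ the F-score against $\mathbf S_{1,\eta},\dots,\mathbf S_{K_\eta,\eta}$ is $$\mathcal F_\eta(\{\mathcal C_j\})=\frac{\sum_{j}\mu(\mathcal C_j)\,\mathcal F_\eta(\mathcal C_j)}{\mu(\bigcup_j\mathcal C_j)},\qquad \mathcal F_\eta(\mathcal C)=2\max_{1\le k\le K_\eta}\frac{\mu(\mathcal C\cap\mathbf S_{k,\eta})}{\mu(\mathcal C)+\mu(\mathbf S_{k,\eta})}.$$ **Theorem.** Let $S>\alpha$. There are constants $C\in(0,1)$, $c_M,c_n,c_S,c_1,c_2,a,b>0$,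 depending only on $\mathbb M,\rho,h,S,\alpha,\kappa_1,\kappa_2,r_0$, and a function $r$ with $a\,\Theta^{-1/(S-\alpha)}\le r(\Theta)\le b\,\Theta^{-1/(S-\alpha)}$ for $0<\Theta<C$, such that the following holds. Let $\mu$ be detectable with parameters $\alpha,\kappa_1,\kappa_2,r_0$ and have a fine structure with $$\lim_{\eta\to0^+}\ \max_{1\le k\le K_\eta}\frac{\mu(\mathbf S_{K_\eta+1,\eta})}{\mu(\mathbf S_{k,\eta})}=0 .$$ Then there is a function $\varepsilon$, depending on $\mu$ and its fine structure only (besides the data above), with $\varepsilon(\eta)\to0$ as $\eta\to0^+$, such that for all $0<\Theta<C$ and all integers $n,M\ge1$ with $M\ge c_Mn^\alpha\log n$ the following holds with probability at least $1-c_1/M^{c_2}$ for independent samples $x_1,\dots,x_M$ from $\mu$. First, $\mathbb X\subseteq\mathcal G_n(\Theta)\subseteq\mathbb B(\mathbb X,r(\Theta)/n)$. Second, simultaneously for all $\eta\in(0,\eta_0]$ with $n\ge c_n/(\eta\,\Theta^{1/(S-\alpha)})$ and $\mu(\mathbf S_{K_\eta+1,\eta})\le c_S\,\Theta\, n^{-\alpha}$,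 the sets $$\mathcal G_{k,\eta,n}(\Theta)=\mathcal G_n(\Theta)\cap\mathbb B(\mathbf S_{k,\eta},r(\Theta)/n),\qquad k=1,\dots,K_\eta,$$ form a partition of $\mathcal G_n(\Theta)$ with $\operatorname{dist}(\mathcal G_{j,\eta,n}(\Theta),\mathcal G_{k,\eta,n}(\Theta))\ge\eta$ for $j\ne k$, and $$\big|\mathcal F_\eta\big(\{\mathcal G_{k,\eta,n}(\Theta)\}_{k=1}^{K_\eta}\big)-1\big|\le\varepsilon(\eta).$$ That is, with probability at least $1-c_1/M^{c_2}$ the F-score tends to $1$ as $\eta\to0^+$, along all admissible $n$, $M$, $\Theta$. -/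

import Mathlib

open MeasureTheory Set Filter Topology

noncomputable section

namespace SupportEstimation

/-- A smooth low-pass filter: an even, nonnegative `C^∞` function on the line, equal to `1` for
`|u| ≤ 1/2` and to `0` for `|u| ≥ 1`. -/
structure IsSmoothFilter (h : ℝ → ℝ) : Prop where
  smooth : ContDiff ℝ ((⊤ : ℕ∞) : WithTop ℕ∞) h
  even : ∀ u, h (-u) = h u
  nonneg : ∀ u, 0 ≤ h u
  eq_one : ∀ u, |u| ≤ 1 / 2 → h u = 1
  eq_zero : ∀ u, 1 ≤ |u| → h u = 0

/-- The trigonometric kernel `Φ_n(t) = ∑_{|k| < n} h(k/n) e^{ikt}`. -/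
def trigKernel (h : ℝ → ℝ) (n : ℕ) (t : ℝ) : ℂ :=
  ∑ k ∈ Finset.Ioo (-(n : ℤ)) (n : ℤ),
    ((h ((k : ℝ) / (n : ℝ)) : ℝ) : ℂ) * Complex.exp (Complex.I * (k : ℂ) * (t : ℂ))

/-- For an even filter `Φ_n` is real valued. -/
theorem trigKernel_im {h : ℝ → ℝ} (hh : IsSmoothFilter h) (n : ℕ) (t : ℝ) :
    (trigKernel h n t).im = 0 := by
  have key : (starRingEnd ℂ) (trigKernel h n t) = trigKernel h n t := by
    unfold trigKernel
    rw [map_sum]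
    refine Finset.sum_bij' (fun k _ => -k) (fun k _ => -k) ?_ ?_ ?_ ?_ ?_
    · intro k hk
      simp only [Finset.mem_Ioo] at hk ⊢
      omega
    · intro k hk
      simp only [Finset.mem_Ioo] at hk ⊢
      omega
    · intro k _
      simp
    · intro k _
      simp
    · intro k _
      have h1 : h (((-k : ℤ) : ℝ) / (n : ℝ)) = h ((k : ℝ) / (n : ℝ)) := by
        rw [← hh.even ((k : ℝ) / (n : ℝ))]
        congr 1
        push_cast
        ring
      rw [h1, map_mul, Complex.conj_ofReal, ← Complex.exp_conj]
      congr 2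
      simp
  exact Complex.conj_eq_iff_im.mp key

/-- Hence the real part used in `locKernel` below is all of `Φ_n(t)^2`. -/
theorem trigKernel_sq_im {h : ℝ → ℝ} (hh : IsSmoothFilter h) (n : ℕ) (t : ℝ) :
    (trigKernel h n t ^ 2).im = 0 := by
  rw [pow_two, Complex.mul_im, trigKernel_im hh]
  ring

section Metric

variable {X : Type*} [MetricSpace X]

/-- The localized kernel `Ψ_n(x,y) = Φ_n(ρ(x,y))^2` (a real number, see `trigKernel_sq_im`). -/
def locKernel (h : ℝ → ℝ) (n : ℕ) (x y : X) : ℝ :=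
  (trigKernel h n (dist x y) ^ 2).re

/-- The support estimator `F_n(x) = (1/M) ∑_j Ψ_n(x, x_j)` built from the data `x_1, …, x_M`. -/
def supportEstimator (h : ℝ → ℝ) (n : ℕ) {M : ℕ} (xs : Fin M → X) (x : X) : ℝ :=
  (1 / (M : ℝ)) * ∑ j, locKernel h n x (xs j)

/-- The support estimation set `G_n(Θ) = {x : F_n(x) ≥ Θ max_k F_n(x_k)}`. -/
def estimationSet (h : ℝ → ℝ) (n : ℕ) {M : ℕ} (xs : Fin M → X) (Θ : ℝ) : Set X :=
  {x | Θ * (⨆ k, supportEstimator h n xs (xs k)) ≤ supportEstimator h n xs x}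

/-- The piece `G_n(Θ) ∩ 𝔹(A, r/n)` of the support estimation set belonging to `A`, where
`𝔹(A, δ) = {x : dist(x, A) ≤ δ}`. -/
def estimationPiece (h : ℝ → ℝ) (n : ℕ) {M : ℕ} (xs : Fin M → X) (Θ r : ℝ) (A : Set X) : Set X :=
  estimationSet h n xs Θ ∩ Metric.cthickening (r / (n : ℝ)) A

/-- `dist(A, B) = inf {ρ(x,y) : x ∈ A, y ∈ B} ≥ d`, where the infimum over the empty set is `∞`. -/
def DistGE (d : ℝ) (A B : Set X) : Prop :=
  ∀ x ∈ A, ∀ y ∈ B, d ≤ dist x y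

/-- The sets `P i` are pairwise disjoint with union `A`. -/
def IsPartition {ι : Type*} (P : ι → Set X) (A : Set X) : Prop :=
  (⋃ i, P i) = A ∧ Pairwise (fun i j => Disjoint (P i) (P j))

variable [MeasurableSpace X]

/-- The measure `μ` is detectable, with exponent `α` and constants `κ₁, κ₂, r₀`. -/
structure IsDetectable (μ : Measure X) (α κ₁ κ₂ r₀ : ℝ) : Prop where
  exponent_nonneg : 0 ≤ α
  upper_pos : 0 < κ₁
  lower_pos : 0 < κ₂
  radius_pos : 0 < r₀
  upper : ∀ (x : X) (r : ℝ), 0 < r → μ.real (Metric.closedBall x r) ≤ κ₁ * r ^ α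
  lower : ∀ x ∈ μ.support, ∀ r : ℝ, 0 < r → r ≤ r₀ → κ₂ * r ^ α ≤ μ.real (Metric.closedBall x r)

/-- A fine structure of `μ`: for each `η ∈ (0, η₀]` a partition of the support of `μ` into Borel
sets `S η 0, …, S η (K η)`, of which the first `K η` are at mutual distance at least `2η`, while
the measure of the remaining set `S η (K η)` tends to `0` as `η → 0⁺`. -/
structure IsFineStructure (μ : Measure X) (η₀ : ℝ) (K : ℝ → ℕ)
    (S : (η : ℝ) → Fin (K η + 1) → Set X) : Prop where
  pos : 0 < η₀
  measurable : ∀ η, 0 < η → η ≤ η₀ → ∀ k, MeasurableSet (S η k)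
  partition : ∀ η, 0 < η → η ≤ η₀ → IsPartition (S η) μ.support
  separation : ∀ η, 0 < η → η ≤ η₀ → ∀ j k : Fin (K η), j ≠ k →
    DistGE (2 * η) (S η j.castSucc) (S η k.castSucc)
  exhaustion : Tendsto (fun η => μ (S η (Fin.last (K η)))) (𝓝[>] 0) (𝓝 0)

/-- The F-score of one cluster `C` against the true pieces `L_1, …, L_K`,
`2 max_k μ(C ∩ L_k) / (μ(C) + μ(L_k))`. -/
def clusterFScore (μ : Measure X) {K : ℕ} (L : Fin K → Set X) (C : Set X) : ℝ :=
  2 * ⨆ k, μ.real (C ∩ L k) / (μ.real C + μ.real (L k))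

/-- The F-score of the clusters `C_1, …, C_N` against the true pieces `L_1, …, L_K`,
`∑_j μ(C_j) F(C_j) / μ(⋃_j C_j)`. -/
def fScore (μ : Measure X) {K N : ℕ} (L : Fin K → Set X) (C : Fin N → Set X) : ℝ :=
  (∑ j, μ.real (C j) * clusterFScore μ L (C j)) / μ.real (⋃ j, C j)

end Metric

end SupportEstimation

end

namespace SupportEstimation

/-! The kernel `Ψ_n` is of size at least `n²/4` within distance `1/n` and at most a constant times
`n² (nρ)^(-s)` beyond it: near the diagonal the terms of `Φ_n` add up without cancellation
(`half_le_trigKernel_re`), and far from it repeated summation by parts against the smooth filter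
gives decay of any order (`exists_trigKernel_decay`).

All probability is confined to one event, that the sample is balanced: the number of points in balls
about the support is comparable to `M ρ^α` from above at all radii `ρ ≥ 1/n` and from below at
radius `1/n`. Chernoff bounds on the balls of a `1/(2n)`-net, which has `O(n^α)` points, and a union
bound show that `M ≥ cM n^α log n` is enough (`exists_event_isBalancedSample`).

On that event everything is deterministic. Summing the kernel over dyadic annuli shows that `F_n` is
of exact order `n^(2-α)` on the support and at most `D n^(2-α) R^(α-s)` at distance `R/n` from it
(`exists_supportEstimator_bounds`). A small threshold `Θ` therefore keeps the support, and it
rejects points once `R` exceeds a multiple of `Θ^(-1/(s-α))`.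

An exceptional set lighter than every `1/n`-ball about the support cannot contain almost all of such
a ball, so enlarging the radius by `1/n` lets the neighborhoods of the main pieces cover the
estimation set, while their `2η` separation drops to no less than `η`
(`estimationPiece_isPartition`). Each piece contains its true set and exceeds it by at most the
exceptional mass, so its F-score is off by at most the ratio of the two masses
(`abs_fScore_sub_one_le`). -/

/-! ### Localization of the trigonometric kernel -/

theorem finite_support_sample {g : ℝ → ℝ} {L n : ℕ} (hn : 1 ≤ n)
    (hg : ∀ x, g x ≠ 0 → -(L : ℝ) ≤ x ∧ x ≤ 1) (z : ℂ) :
    Function.support (fun k : ℤ => ((g ((k : ℝ) / n) : ℝ) : ℂ) * z ^ k) ⊆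
      (Finset.Icc (-(L * n : ℤ)) (n : ℤ) : Finset ℤ) := by
  intro k hk
  have hn0 : (0 : ℝ) < n := by exact_mod_cast hn
  have h1 : g ((k : ℝ) / n) ≠ 0 := by
    intro h0
    apply hk
    simp [h0]
  obtain ⟨h2, h3⟩ := hg _ h1
  rw [le_div_iff₀ hn0] at h2
  rw [div_le_iff₀ hn0] at h3
  simp only [Finset.coe_Icc, Set.mem_Icc]
  constructor
  · have : ((-(L * n : ℤ) : ℤ) : ℝ) ≤ (k : ℝ) := by push_cast; linarith
    exact_mod_cast this
  · have : (k : ℝ) ≤ ((n : ℤ) : ℝ) := by push_cast; linarith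
    exact_mod_cast this

/-- Summation by parts: `Q` differences of a sampled smooth function of compact support gain a
factor `n ^ (-Q)`. -/
theorem pow_mul_norm_finsum_le {n : ℕ} (hn : 1 ≤ n) {z : ℂ} (hz : ‖z‖ = 1) (Q : ℕ) :
    ∀ (g : ℝ → ℝ) (L : ℕ) (B : ℝ), ContDiff ℝ ((⊤ : ℕ∞) : WithTop ℕ∞) g →
      (∀ x, g x ≠ 0 → -(L : ℝ) ≤ x ∧ x ≤ 1) → (∀ x, |iteratedDeriv Q g x| ≤ B) →
      ‖z - 1‖ ^ Q * ‖∑ᶠ k : ℤ, ((g ((k : ℝ) / n) : ℝ) : ℂ) * z ^ k‖ ≤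
        B / (n : ℝ) ^ Q * ((L + Q + 1) * n + 1) := by
  have hn0 : (0 : ℝ) < n := by exact_mod_cast hn
  have hz0 : z ≠ 0 := by
    intro h0
    simp [h0] at hz
  induction Q with
  | zero =>
    intro g L B _ hsupp hB
    rw [finsum_eq_sum_of_support_subset _ (finite_support_sample hn hsupp z)]
    have h1 : ‖∑ k ∈ Finset.Icc (-(L * n : ℤ)) (n : ℤ), ((g ((k : ℝ) / n) : ℝ) : ℂ) * z ^ k‖ ≤
        ∑ k ∈ Finset.Icc (-(L * n : ℤ)) (n : ℤ), B := by
      refine norm_sum_le_of_le _ fun k _ => ?_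
      rw [norm_mul, norm_zpow, hz, one_zpow, mul_one, Complex.norm_real]
      simpa using hB ((k : ℝ) / n)
    have h2 : ((Finset.Icc (-(L * n : ℤ)) (n : ℤ)).card : ℝ) = (L + 1) * n + 1 := by
      rw [Int.card_Icc]
      have h3 : ((n : ℤ) + 1 - -(L * n : ℤ)) = (((L + 1) * n + 1 : ℕ) : ℤ) := by push_cast; ring
      rw [h3, Int.toNat_natCast]
      push_cast
      ring
    rw [Finset.sum_const, nsmul_eq_mul, h2] at h1
    simpa [mul_comm] using h1
  | succ Q ih =>
    intro g L B hg hsupp hB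
    -- A forward difference enlarges the support only to the left, by at most `1`, and by the mean
    -- value inequality costs one derivative for a factor `1/n`. Hence the induction varies `g`, `L`
    -- and `B`.
    set g₁ : ℝ → ℝ := fun x => g (x + 1 / n) - g x with hg₁
    have hshift : ContDiff ℝ ((⊤ : ℕ∞) : WithTop ℕ∞) (fun x => g (x + 1 / n)) :=
      hg.comp (contDiff_id.add contDiff_const)
    have hg₁s : ContDiff ℝ ((⊤ : ℕ∞) : WithTop ℕ∞) g₁ := hshift.sub hg
    have hn1 : 1 / (n : ℝ) ≤ 1 := by
      rw [div_le_one hn0]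
      exact_mod_cast hn
    have hsupp₁ : ∀ x, g₁ x ≠ 0 → -((L + 1 : ℕ) : ℝ) ≤ x ∧ x ≤ 1 := by
      intro x hx
      have hpos : 0 < 1 / (n : ℝ) := by positivity
      have hL : (0 : ℝ) ≤ L := by positivity
      push_cast
      by_cases h0 : g x = 0
      · have h1 : g (x + 1 / n) ≠ 0 := by
          intro h1
          apply hx
          simp only [hg₁, h0, h1, sub_zero]
        obtain ⟨h2, h3⟩ := hsupp _ h1
        constructor <;> linarith
      · obtain ⟨h2, h3⟩ := hsupp _ h0
        constructor <;> linarith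
    have hB₁ : ∀ x, |iteratedDeriv Q g₁ x| ≤ B / n := by
      intro x
      have h1 : iteratedDeriv Q g₁ x = iteratedDeriv Q g (x + 1 / n) - iteratedDeriv Q g x := by
        have := iteratedDeriv_fun_sub (n := Q) (x := x)
          (f := fun x => g (x + 1 / n)) (g := g)
          ((hshift.of_le (by exact_mod_cast le_top)).contDiffAt)
          ((hg.of_le (by exact_mod_cast le_top)).contDiffAt)
        rw [hg₁, this, iteratedDeriv_comp_add_const]
      have hd : Differentiable ℝ (iteratedDeriv Q g) :=
        hg.differentiable_iteratedDeriv Q (by exact_mod_cast WithTop.coe_lt_top _)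
      have h2 := Convex.norm_image_sub_le_of_norm_deriv_le (f := iteratedDeriv Q g) (C := B)
        (s := Set.univ) (x := x) (y := x + 1 / n) (fun y _ => hd y)
        (fun y _ => by rw [← iteratedDeriv_succ]; exact hB y) convex_univ (mem_univ _) (mem_univ _)
      rw [h1]
      simp only [Real.norm_eq_abs, add_sub_cancel_left] at h2
      rwa [abs_of_pos (by positivity : 0 < 1 / (n : ℝ)), mul_one_div] at h2
    -- Reindexing `k ↦ k + 1` turns the difference into the factor `z⁻¹ - 1`, which has the same
    -- modulus as `z - 1` on the unit circle.
    have hsum : ∑ᶠ k : ℤ, ((g₁ ((k : ℝ) / n) : ℝ) : ℂ) * z ^ k =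
        (z⁻¹ - 1) * ∑ᶠ k : ℤ, ((g ((k : ℝ) / n) : ℝ) : ℂ) * z ^ k := by
      have hf := (Finset.finite_toSet _).subset (finite_support_sample hn hsupp z)
      have hshift1 : ∑ᶠ k : ℤ, z⁻¹ * (((g (((k + 1 : ℤ) : ℝ) / n) : ℝ) : ℂ) * z ^ (k + 1)) =
          ∑ᶠ k : ℤ, z⁻¹ * (((g ((k : ℝ) / n) : ℝ) : ℂ) * z ^ k) :=
        finsum_comp_equiv (Equiv.addRight (1 : ℤ))
          (f := fun k : ℤ => z⁻¹ * (((g ((k : ℝ) / n) : ℝ) : ℂ) * z ^ k))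
      have hf2 : (Function.support
          (fun k : ℤ => z⁻¹ * (((g ((k : ℝ) / n) : ℝ) : ℂ) * z ^ k))).Finite :=
        hf.subset (Function.support_mul_subset_right _ _)
      have hf3 : (Function.support (fun k : ℤ =>
          z⁻¹ * (((g (((k + 1 : ℤ) : ℝ) / n) : ℝ) : ℂ) * z ^ (k + 1)))).Finite := by
        have := hf2.preimage ((Equiv.addRight (1 : ℤ)).injective.injOn)
        exact this
      rw [sub_mul, one_mul, mul_finsum, ← hshift1, ← finsum_sub_distrib hf3 hf]
      refine finsum_congr fun k => ?_
      have h1 : ((k : ℝ) / n + 1 / n) = ((k + 1 : ℤ) : ℝ) / n := by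
        push_cast
        ring
      simp only [hg₁, h1, Complex.ofReal_sub]
      rw [zpow_add_one₀ hz0]
      field_simp
    have hzn : ‖z⁻¹ - 1‖ = ‖z - 1‖ := by
      have : z⁻¹ - 1 = -(z⁻¹ * (z - 1)) := by field_simp; ring
      rw [this, norm_neg, norm_mul, norm_inv, hz, inv_one, one_mul]
    have key := ih g₁ (L + 1) (B / n) hg₁s hsupp₁ hB₁
    rw [hsum, norm_mul, hzn, ← mul_assoc, ← pow_succ] at key
    refine key.trans (le_of_eq ?_)
    push_cast
    field_simp
    ring

theorem IsSmoothFilter.hasCompactSupport {h : ℝ → ℝ} (hh : IsSmoothFilter h) :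
    HasCompactSupport h := by
  refine HasCompactSupport.intro (isCompact_Icc (a := (-1 : ℝ)) (b := 1)) fun x hx => ?_
  apply hh.eq_zero
  by_contra hlt
  push Not at hlt
  exact hx ⟨(abs_lt.mp hlt).1.le, (abs_lt.mp hlt).2.le⟩

theorem IsSmoothFilter.exists_abs_iteratedDeriv_le {h : ℝ → ℝ} (hh : IsSmoothFilter h) (Q : ℕ) :
    ∃ B, ∀ x, |iteratedDeriv Q h x| ≤ B := by
  have hc : Continuous (iteratedDeriv Q h) :=
    hh.smooth.continuous_iteratedDeriv Q (by exact_mod_cast le_top)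
  have hs : HasCompactSupport (iteratedDeriv Q h) := by
    have h1 := hh.hasCompactSupport.iteratedFDeriv (𝕜 := ℝ) Q
    refine h1.comp_left (g := fun m => m fun _ => (1 : ℝ)) ?_
    simp
  obtain ⟨B, hB⟩ := hs.exists_bound_of_continuous hc
  exact ⟨B, hB⟩

/-- Since `h` vanishes for `|u| ≥ 1`, the sum may run over all integers, where summation by parts
has no boundary terms. -/
theorem trigKernel_eq_finsum {h : ℝ → ℝ} (hh : IsSmoothFilter h) {n : ℕ} (hn : 1 ≤ n) (t : ℝ) :
    trigKernel h n t =
      ∑ᶠ k : ℤ, ((h ((k : ℝ) / n) : ℝ) : ℂ) * (Complex.exp (Complex.I * (t : ℂ))) ^ k := by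
  have hn0 : (0 : ℝ) < n := by exact_mod_cast hn
  rw [finsum_eq_sum_of_support_subset (s := Finset.Ioo (-(n : ℤ)) (n : ℤ))]
  · unfold trigKernel
    refine Finset.sum_congr rfl fun k _ => ?_
    rw [← Complex.exp_int_mul]
    congr 2
    ring
  · intro k hk
    have h1 : h ((k : ℝ) / n) ≠ 0 := by
      intro h0
      apply hk
      simp [h0]
    have h2 : |(k : ℝ) / n| < 1 := by
      by_contra hge
      exact h1 (hh.eq_zero _ (not_lt.mp hge))
    rw [abs_div, abs_of_pos hn0, div_lt_one hn0] at h2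
    have h3 : |k| < (n : ℤ) := by exact_mod_cast h2
    simpa [abs_lt] using h3

/-- The localization estimate for `Φ_n`. -/
theorem exists_trigKernel_decay {h : ℝ → ℝ} (hh : IsSmoothFilter h) (Q : ℕ) :
    ∃ B, 0 ≤ B ∧ ∀ n : ℕ, 1 ≤ n → ∀ t : ℝ, 0 ≤ t → t ≤ Real.pi →
      ((n : ℝ) * t) ^ Q * ‖trigKernel h n t‖ ≤ B * n := by
  obtain ⟨D, hD⟩ := hh.exists_abs_iteratedDeriv_le Q
  have hD0 : 0 ≤ D := (abs_nonneg _).trans (hD 0)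
  refine ⟨(Real.pi / 2) ^ Q * (D * (Q + 3)), by positivity, fun n hn t ht0 htpi => ?_⟩
  have hn0 : (0 : ℝ) < n := by exact_mod_cast hn
  have hn1 : (1 : ℝ) ≤ n := by exact_mod_cast hn
  have hz : ‖Complex.exp (Complex.I * (t : ℂ))‖ = 1 := by
    rw [mul_comm, Complex.norm_exp_ofReal_mul_I]
  have hsupp : ∀ x, h x ≠ 0 → -((1 : ℕ) : ℝ) ≤ x ∧ x ≤ 1 := by
    intro x hx
    have : |x| < 1 := by
      by_contra hge
      exact hx (hh.eq_zero _ (not_lt.mp hge))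
    push_cast
    exact ⟨(abs_lt.mp this).1.le, (abs_lt.mp this).2.le⟩
  have key := pow_mul_norm_finsum_le hn hz Q h 1 D hh.smooth hsupp hD
  rw [← trigKernel_eq_finsum hh hn] at key
  -- Jordan's inequality for `2 sin(t/2)`; this is where `t ≤ π`, and so the diameter of the space,
  -- enters.
  have hz1 : 2 / Real.pi * t ≤ ‖Complex.exp (Complex.I * (t : ℂ)) - 1‖ := by
    rw [Complex.norm_exp_I_mul_ofReal_sub_one, Real.norm_eq_abs]
    have := Real.mul_le_sin (x := t / 2) (by linarith) (by linarith)
    refine le_trans ?_ (le_abs_self _)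
    linarith
  have h1 : (2 / Real.pi * t) ^ Q * ‖trigKernel h n t‖ ≤
      D / (n : ℝ) ^ Q * (((1 : ℕ) + Q + 1) * n + 1) :=
    le_trans (by gcongr) key
  have hpi := Real.pi_pos
  calc ((n : ℝ) * t) ^ Q * ‖trigKernel h n t‖
      = (Real.pi / 2) ^ Q * (n : ℝ) ^ Q * ((2 / Real.pi * t) ^ Q * ‖trigKernel h n t‖) := by
        rw [← mul_assoc, ← mul_pow, ← mul_pow]
        congr 2
        field_simp
    _ ≤ (Real.pi / 2) ^ Q * (n : ℝ) ^ Q * (D / (n : ℝ) ^ Q * (((1 : ℕ) + Q + 1) * n + 1)) := by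
        gcongr
    _ = (Real.pi / 2) ^ Q * (D * ((Q + 2) * n + 1)) := by
        push_cast
        field_simp
        ring
    _ ≤ (Real.pi / 2) ^ Q * (D * ((Q + 3) * n)) := by
        gcongr
        linarith
    _ = _ := by ring

/-- Near the diagonal `Φ_n` is at least `n / 2`. -/
theorem half_le_trigKernel_re {h : ℝ → ℝ} (hh : IsSmoothFilter h) {n : ℕ} (hn : 1 ≤ n) {t : ℝ}
    (ht0 : 0 ≤ t) (ht : t ≤ 1 / n) : (n : ℝ) / 2 ≤ (trigKernel h n t).re := by
  have hn0 : (0 : ℝ) < n := by exact_mod_cast hn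
  have hterm : ∀ k : ℤ, ((((h ((k : ℝ) / (n : ℝ)) : ℝ) : ℂ) *
      Complex.exp (Complex.I * (k : ℂ) * (t : ℂ)))).re = h ((k : ℝ) / n) * Real.cos (k * t) := by
    intro k
    rw [Complex.re_ofReal_mul]
    have : Complex.I * (k : ℂ) * (t : ℂ) = (((k : ℝ) * t : ℝ) : ℂ) * Complex.I := by
      push_cast
      ring
    rw [this, Complex.exp_ofReal_mul_I_re]
  have hcos : ∀ k ∈ Finset.Ioo (-(n : ℤ)) (n : ℤ), 1 / 2 ≤ Real.cos (k * t) := by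
    intro k hk
    rw [Finset.mem_Ioo] at hk
    have h1 : |(k : ℝ)| ≤ n := by
      rw [abs_le]
      constructor
      · exact_mod_cast hk.1.le
      · exact_mod_cast hk.2.le
    have h2 : |(k : ℝ) * t| ≤ 1 := by
      rw [abs_mul, abs_of_nonneg ht0]
      calc |(k : ℝ)| * t ≤ n * (1 / n) := by gcongr
        _ = 1 := by field_simp
    have h3 := Real.one_sub_sq_div_two_le_cos (x := (k : ℝ) * t)
    have h4 : ((k : ℝ) * t) ^ 2 ≤ 1 := by
      rw [← sq_abs]
      exact pow_le_one₀ (abs_nonneg _) h2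
    linarith
  unfold trigKernel
  rw [Complex.re_sum]
  simp only [hterm]
  -- There are `2⌊n/2⌋ + 1 ≥ n` frequencies at which the filter equals `1`; each contributes at
  -- least `1/2`, and the others are nonnegative because `|kt| ≤ 1`.
  have hm : (n : ℝ) ≤ ((Finset.Icc (-((n / 2 : ℕ) : ℤ)) ((n / 2 : ℕ) : ℤ)).card : ℝ) := by
    rw [Int.card_Icc]
    have : n ≤ (((n / 2 : ℕ) : ℤ) + 1 - -((n / 2 : ℕ) : ℤ)).toNat := by omega
    exact_mod_cast this
  calc (n : ℝ) / 2
      ≤ ∑ k ∈ Finset.Icc (-((n / 2 : ℕ) : ℤ)) ((n / 2 : ℕ) : ℤ), (1 / 2 : ℝ) := by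
        rw [Finset.sum_const, nsmul_eq_mul]
        linarith
    _ ≤ ∑ k ∈ Finset.Icc (-((n / 2 : ℕ) : ℤ)) ((n / 2 : ℕ) : ℤ),
          h ((k : ℝ) / n) * Real.cos (k * t) := by
        refine Finset.sum_le_sum fun k hk => ?_
        rw [Finset.mem_Icc] at hk
        have h1 : h ((k : ℝ) / n) = 1 := by
          apply hh.eq_one
          rw [abs_div, abs_of_pos hn0, div_le_iff₀ hn0]
          have h2 : 2 * |k| ≤ (n : ℤ) := by
            have : |k| ≤ ((n / 2 : ℕ) : ℤ) := abs_le.mpr hk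
            omega
          have h3 : 2 * |(k : ℝ)| ≤ n := by exact_mod_cast h2
          linarith
        rw [h1, one_mul]
        apply hcos
        rw [Finset.mem_Ioo]
        omega
    _ ≤ ∑ k ∈ Finset.Ioo (-(n : ℤ)) (n : ℤ), h ((k : ℝ) / n) * Real.cos (k * t) := by
        refine Finset.sum_le_sum_of_subset_of_nonneg ?_ fun k hk _ => ?_
        · intro k hk
          rw [Finset.mem_Icc] at hk
          rw [Finset.mem_Ioo]
          omega
        · exact mul_nonneg (hh.nonneg _) (by linarith [hcos k hk])

theorem trigKernel_sq_re {h : ℝ → ℝ} (hh : IsSmoothFilter h) (n : ℕ) (t : ℝ) :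
    (trigKernel h n t ^ 2).re = (trigKernel h n t).re ^ 2 := by
  rw [pow_two, Complex.mul_re, trigKernel_im hh]
  ring

theorem trigKernel_re_sq_eq_norm_sq {h : ℝ → ℝ} (hh : IsSmoothFilter h) (n : ℕ) (t : ℝ) :
    (trigKernel h n t ^ 2).re = ‖trigKernel h n t‖ ^ 2 := by
  rw [trigKernel_sq_re hh, Complex.sq_norm, Complex.normSq_apply, trigKernel_im hh]
  ring

/-! ### The localized kernel on the metric space -/

section Metric

variable {X : Type*} [MetricSpace X]

theorem locKernel_nonneg {h : ℝ → ℝ} (hh : IsSmoothFilter h) (n : ℕ) (x y : X) :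
    0 ≤ locKernel h n x y := by
  unfold locKernel
  rw [trigKernel_sq_re hh]
  positivity

theorem le_locKernel {h : ℝ → ℝ} (hh : IsSmoothFilter h) {n : ℕ} (hn : 1 ≤ n) {x y : X}
    (hxy : dist x y ≤ 1 / n) : (n : ℝ) ^ 2 / 4 ≤ locKernel h n x y := by
  unfold locKernel
  rw [trigKernel_sq_re hh]
  have h1 := half_le_trigKernel_re hh hn dist_nonneg hxy
  calc (n : ℝ) ^ 2 / 4 = ((n : ℝ) / 2) ^ 2 := by ring
    _ ≤ _ := by gcongr

theorem continuous_locKernel_left (h : ℝ → ℝ) (n : ℕ) (y : X) :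
    Continuous fun x => locKernel h n x y := by
  unfold locKernel trigKernel
  fun_prop

/-- The localized kernel is `O(n ^ 2)`, and `O(n ^ 2 (n ρ) ^ (-s))` at distance `ρ ≥ 1 / n`. -/
theorem exists_locKernel_le {h : ℝ → ℝ} (hh : IsSmoothFilter h) (s : ℝ)
    (hd : ∀ x y : X, dist x y ≤ Real.pi) :
    ∃ B : ℝ, 0 < B ∧ ∀ n : ℕ, 1 ≤ n → ∀ x y : X, locKernel h n x y ≤ B * (n : ℝ) ^ 2 ∧
      (1 ≤ n * dist x y → locKernel h n x y ≤ B * (n : ℝ) ^ 2 * (n * dist x y) ^ (-s)) := by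
  obtain ⟨Q, hQ⟩ := exists_nat_ge s
  obtain ⟨B₀, hB₀, h0⟩ := exists_trigKernel_decay hh 0
  obtain ⟨B₁, hB₁, h1⟩ := exists_trigKernel_decay hh Q
  refine ⟨B₀ ^ 2 + B₁ ^ 2 + 1, by positivity, fun n hn x y => ⟨?_, fun hxy => ?_⟩⟩
  · have h2 := h0 n hn (dist x y) dist_nonneg (hd x y)
    rw [pow_zero, one_mul] at h2
    unfold locKernel
    rw [trigKernel_re_sq_eq_norm_sq hh]
    calc ‖trigKernel h n (dist x y)‖ ^ 2 ≤ (B₀ * n) ^ 2 := by gcongr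
      _ = B₀ ^ 2 * (n : ℝ) ^ 2 := by ring
      _ ≤ _ := by
        gcongr
        nlinarith [sq_nonneg B₁]
  · have h2 := h1 n hn (dist x y) dist_nonneg (hd x y)
    unfold locKernel
    rw [trigKernel_re_sq_eq_norm_sq hh]
    set u := (n : ℝ) * dist x y with hu
    have hu0 : 0 < u := by linarith
    have h3 : u ^ s ≤ (u ^ Q) ^ 2 := by
      rw [← pow_mul, ← Real.rpow_natCast]
      apply Real.rpow_le_rpow_of_exponent_le hxy
      push_cast
      have : (0 : ℝ) ≤ Q := by positivity
      linarith
    rw [Real.rpow_neg hu0.le, ← div_eq_mul_inv, le_div_iff₀ (by positivity)]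
    calc ‖trigKernel h n (dist x y)‖ ^ 2 * u ^ s
        ≤ ‖trigKernel h n (dist x y)‖ ^ 2 * (u ^ Q) ^ 2 := by gcongr
      _ = (u ^ Q * ‖trigKernel h n (dist x y)‖) ^ 2 := by ring
      _ ≤ (B₁ * n) ^ 2 := by gcongr
      _ = B₁ ^ 2 * (n : ℝ) ^ 2 := by ring
      _ ≤ _ := by
        gcongr
        nlinarith [sq_nonneg B₀]

end Metric

/-- The number of sample points lying in `A`, as a real number. -/
noncomputable def sampleCount {X : Type*} {M : ℕ} (xs : Fin M → X) (A : Set X) : ℝ :=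
  ∑ i, A.indicator (fun _ => (1 : ℝ)) (xs i)

/-! ### Deterministic bounds for the estimator on balanced samples -/

section Metric

variable {X : Type*} [MetricSpace X]

/-- The sample `xs` from `Y` has the expected number of points, up to constants, in all balls of
radius `1 / n` about points of `Y`, and not more than expected in all larger balls. -/
structure IsBalancedSample (n : ℕ) {M : ℕ} (xs : Fin M → X) (Y : Set X) (α A c : ℝ) : Prop where
  mem : ∀ i, xs i ∈ Y
  upper : ∀ (x : X) (ρ : ℝ), 1 / (n : ℝ) ≤ ρ →
    sampleCount xs (Metric.closedBall x ρ) ≤ A * M * ρ ^ α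
  lower : ∀ x ∈ Y, c * M * (n : ℝ) ^ (-α) ≤ sampleCount xs (Metric.closedBall x (1 / n))

theorem geom_sum_le_inv {q : ℝ} (hq0 : 0 ≤ q) (hq1 : q < 1) (I : ℕ) :
    ∑ i ∈ Finset.range I, q ^ i ≤ (1 - q)⁻¹ := by
  have h1 : 0 < 1 - q := by linarith
  rw [← one_div, le_div_iff₀ h1, geom_sum_mul_neg]
  linarith [pow_nonneg hq0 I]

/-- Sum of the kernel over the samples at distance at least `R / n`. -/
theorem exists_tail_le {h : ℝ → ℝ} {s α A B : ℝ} (hα : 0 ≤ α)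
    (hs : α < s) (hA : 0 < A) (hB : 0 < B)
    (hd : ∀ x y : X, dist x y ≤ Real.pi)
    (hker : ∀ n : ℕ, 1 ≤ n → ∀ x y : X, 1 ≤ n * dist x y →
      locKernel h n x y ≤ B * (n : ℝ) ^ 2 * (n * dist x y) ^ (-s)) :
    ∃ D : ℝ, 0 < D ∧ ∀ n : ℕ, 1 ≤ n → ∀ (M : ℕ) (xs : Fin M → X),
      (∀ (x : X) (ρ : ℝ), 1 / (n : ℝ) ≤ ρ →
        sampleCount xs (Metric.closedBall x ρ) ≤ A * M * ρ ^ α) →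
      ∀ (x : X) (R : ℝ), 1 ≤ R →
        ∑ j, {y | R ≤ n * dist x y}.indicator (fun y => locKernel h n x y) (xs j) ≤
          D * M * ((n : ℝ) ^ 2 * (n : ℝ) ^ (-α)) * R ^ (α - s) := by
  -- On the annulus `2^i R ≤ nρ < 2^(i+1) R` the kernel decays like `2^(-is)` while the count grows
  -- like `2^(iα)`, so the annuli form a geometric series of ratio `q`.
  set q : ℝ := 2 ^ (α - s) with hq
  have hq0 : 0 ≤ q := by positivity
  have hq1 : q < 1 := Real.rpow_lt_one_of_one_lt_of_neg (by norm_num) (by linarith)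
  have hq2 : 0 < (1 - q)⁻¹ := inv_pos.mpr (by linarith)
  refine ⟨B * A * 2 ^ α * (1 - q)⁻¹, by positivity, fun n hn M xs hup x R hR => ?_⟩
  have hn0 : (0 : ℝ) < n := by exact_mod_cast hn
  have hR0 : 0 < R := by linarith
  -- Distances are at most `π`, so annuli with `i ≥ n π` are empty and a finite sum suffices.
  obtain ⟨I, hI⟩ := exists_nat_ge ((n : ℝ) * Real.pi)
  have hpt : ∀ y : X, {y | R ≤ n * dist x y}.indicator (fun y => locKernel h n x y) y ≤
      ∑ i ∈ Finset.range I, B * (n : ℝ) ^ 2 * (2 ^ i * R) ^ (-s) *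
        (Metric.closedBall x (2 ^ (i + 1) * R / n)).indicator (fun _ => (1 : ℝ)) y := by
    intro y
    have hnn : ∀ i ∈ Finset.range I, 0 ≤ B * (n : ℝ) ^ 2 * (2 ^ i * R) ^ (-s) *
        (Metric.closedBall x (2 ^ (i + 1) * R / n)).indicator (fun _ => (1 : ℝ)) y := by
      intro i _
      have : 0 ≤ (Metric.closedBall x (2 ^ (i + 1) * R / n)).indicator (fun _ => (1 : ℝ)) y :=
        indicator_nonneg (fun _ _ => zero_le_one) _
      positivity
    by_cases hy : R ≤ n * dist x y
    · rw [indicator_of_mem (show y ∈ {y | R ≤ n * dist x y} from hy)]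
      obtain ⟨i, hi1, hi2⟩ := exists_nat_pow_near (x := n * dist x y / R) (y := (2 : ℝ))
        ((one_le_div hR0).mpr hy) (by norm_num)
      rw [le_div_iff₀ hR0] at hi1
      rw [div_lt_iff₀ hR0] at hi2
      have hiI : i ∈ Finset.range I := by
        rw [Finset.mem_range]
        have h1 : (i : ℝ) < 2 ^ i := by exact_mod_cast Nat.lt_two_pow_self
        have h2 : (2 : ℝ) ^ i ≤ 2 ^ i * R := le_mul_of_one_le_right (by positivity) hR
        have h3 : (n : ℝ) * dist x y ≤ n * Real.pi := by gcongr; exact hd x y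
        have h4 : (i : ℝ) < I := by linarith
        exact_mod_cast h4
      have hmem : y ∈ Metric.closedBall x (2 ^ (i + 1) * R / n) := by
        rw [Metric.mem_closedBall, dist_comm, le_div_iff₀ hn0]
        linarith
      refine le_trans ?_ (Finset.single_le_sum hnn hiI)
      rw [indicator_of_mem hmem, mul_one]
      refine (hker n hn x y (hR.trans hy)).trans ?_
      gcongr ?_ * ?_
      exact Real.rpow_le_rpow_of_nonpos (by positivity) hi1 (by linarith)
    · rw [indicator_of_notMem (show y ∉ {y | R ≤ n * dist x y} from hy)]
      exact Finset.sum_nonneg hnn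
  calc ∑ j, {y | R ≤ n * dist x y}.indicator (fun y => locKernel h n x y) (xs j)
      ≤ ∑ j, ∑ i ∈ Finset.range I, B * (n : ℝ) ^ 2 * (2 ^ i * R) ^ (-s) *
        (Metric.closedBall x (2 ^ (i + 1) * R / n)).indicator (fun _ => (1 : ℝ)) (xs j) :=
        Finset.sum_le_sum fun j _ => hpt (xs j)
    _ = ∑ i ∈ Finset.range I, B * (n : ℝ) ^ 2 * (2 ^ i * R) ^ (-s) *
          sampleCount xs (Metric.closedBall x (2 ^ (i + 1) * R / n)) := by
        rw [Finset.sum_comm]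
        simp only [sampleCount, Finset.mul_sum]
    _ ≤ ∑ i ∈ Finset.range I, B * (n : ℝ) ^ 2 * (2 ^ i * R) ^ (-s) *
          (A * M * (2 ^ (i + 1) * R / n) ^ α) := by
        refine Finset.sum_le_sum fun i _ => ?_
        gcongr
        apply hup
        gcongr
        have : (1 : ℝ) ≤ 2 ^ (i + 1) := one_le_pow₀ (by norm_num)
        nlinarith
    _ = ∑ i ∈ Finset.range I, (B * A * 2 ^ α * M * ((n : ℝ) ^ 2 * (n : ℝ) ^ (-α)) *
          R ^ (α - s)) * q ^ i := by
        refine Finset.sum_congr rfl fun i _ => ?_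
        have e1 : ((2 : ℝ) ^ i * R) ^ (-s) = (2 : ℝ) ^ (-(i * s)) * R ^ (-s) := by
          rw [Real.mul_rpow (by positivity) hR0.le, ← Real.rpow_natCast, ← Real.rpow_mul (by norm_num)]
          ring_nf
        have e2 : ((2 : ℝ) ^ (i + 1) * R / n) ^ α =
            (2 : ℝ) ^ (i * α) * 2 ^ α * R ^ α * (n : ℝ) ^ (-α) := by
          rw [Real.div_rpow (by positivity) hn0.le, Real.mul_rpow (by positivity) hR0.le,
            ← Real.rpow_natCast, ← Real.rpow_mul (by norm_num), Real.rpow_neg hn0.le,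
            ← div_eq_mul_inv, ← Real.rpow_add (by norm_num)]
          push_cast
          ring_nf
        have e3 : q ^ i = (2 : ℝ) ^ (i * α) * (2 : ℝ) ^ (-(i * s)) := by
          rw [hq, ← Real.rpow_natCast, ← Real.rpow_mul (by norm_num),
            ← Real.rpow_add (by norm_num)]
          ring_nf
        have e4 : R ^ (α - s) = R ^ α * R ^ (-s) := by
          rw [← Real.rpow_add hR0]
          ring_nf
        rw [e1, e2, e3, e4]
        ring
    _ ≤ (B * A * 2 ^ α * M * ((n : ℝ) ^ 2 * (n : ℝ) ^ (-α)) * R ^ (α - s)) * (1 - q)⁻¹ := by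
        rw [← Finset.mul_sum]
        gcongr
        exact geom_sum_le_inv hq0 hq1 I
    _ = _ := by ring

/-- On balanced samples the support estimator is of exact order `n ^ (2 - α)` on `Y` and decays
like `(n dist(x, Y)) ^ (α - s)` away from it. -/
theorem exists_supportEstimator_bounds {h : ℝ → ℝ} (hh : IsSmoothFilter h) {s α A c : ℝ}
    (hα : 0 ≤ α) (hs : α < s) (hA : 0 < A) (hc : 0 < c)
    (hd : ∀ x y : X, dist x y ≤ Real.pi) :
    ∃ D L : ℝ, 0 < D ∧ 0 < L ∧ ∀ n : ℕ, 1 ≤ n → ∀ M : ℕ, 1 ≤ M → ∀ (xs : Fin M → X) (Y : Set X),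
      IsBalancedSample n xs Y α A c → ∀ x : X,
        supportEstimator h n xs x ≤ D * ((n : ℝ) ^ 2 * (n : ℝ) ^ (-α)) ∧
        (x ∈ Y → L * ((n : ℝ) ^ 2 * (n : ℝ) ^ (-α)) ≤ supportEstimator h n xs x) ∧
        ∀ R : ℝ, 1 ≤ R → (∀ y ∈ Y, R ≤ n * dist x y) →
          supportEstimator h n xs x ≤ D * ((n : ℝ) ^ 2 * (n : ℝ) ^ (-α)) * R ^ (α - s) := by
  obtain ⟨B, hB, hker⟩ := exists_locKernel_le hh s hd
  obtain ⟨D, hD, htail⟩ := exists_tail_le hα hs hA hB hd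
    (fun n hn x y hxy => (hker n hn x y).2 hxy)
  -- `B * A` accounts for the ball of radius `1/n` and `D` for the tail from `R = 1`; `c / 4` comes
  -- from the value `n²/4` near the diagonal.
  refine ⟨D + B * A, c / 4, by positivity, by positivity, fun n hn M hM xs Y hbal x => ?_⟩
  have hn0 : (0 : ℝ) < n := by exact_mod_cast hn
  have hM0 : (0 : ℝ) < M := by exact_mod_cast hM
  refine ⟨?_, fun hx => ?_, fun R hR hfar => ?_⟩
  · have hpt : ∀ y, locKernel h n x y ≤
        B * (n : ℝ) ^ 2 * (Metric.closedBall x (1 / n)).indicator (fun _ => (1 : ℝ)) y +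
          {y | 1 ≤ n * dist x y}.indicator (fun y => locKernel h n x y) y := by
      intro y
      by_cases hy : 1 ≤ n * dist x y
      · rw [indicator_of_mem (show y ∈ {y | 1 ≤ n * dist x y} from hy)]
        have : 0 ≤ (Metric.closedBall x (1 / (n : ℝ))).indicator (fun _ => (1 : ℝ)) y :=
          indicator_nonneg (fun _ _ => zero_le_one) _
        have : 0 ≤ B * (n : ℝ) ^ 2 *
          (Metric.closedBall x (1 / (n : ℝ))).indicator (fun _ => (1 : ℝ)) y := by positivity
        linarith
      · have hmem : y ∈ Metric.closedBall x (1 / (n : ℝ)) := by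
          rw [Metric.mem_closedBall, dist_comm, le_div_iff₀ hn0]
          linarith
        rw [indicator_of_notMem (show y ∉ {y | 1 ≤ n * dist x y} from hy),
          indicator_of_mem hmem, mul_one, add_zero]
        exact (hker n hn x y).1
    have h1 : ∑ j, locKernel h n x (xs j) ≤
        B * (n : ℝ) ^ 2 * (A * M * (n : ℝ) ^ (-α)) +
          D * M * ((n : ℝ) ^ 2 * (n : ℝ) ^ (-α)) * 1 ^ (α - s) := by
      refine (Finset.sum_le_sum fun j _ => hpt (xs j)).trans ?_
      rw [Finset.sum_add_distrib, ← Finset.mul_sum]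
      have h2 := hbal.upper x (1 / n) le_rfl
      rw [one_div, Real.inv_rpow hn0.le, ← Real.rpow_neg hn0.le] at h2
      gcongr
      · rw [one_div]; exact h2
      · exact htail n hn M xs hbal.upper x 1 le_rfl
    rw [Real.one_rpow, mul_one] at h1
    unfold supportEstimator
    rw [one_div, inv_mul_le_iff₀ hM0]
    refine h1.trans (le_of_eq ?_)
    ring
  · unfold supportEstimator
    rw [one_div, le_inv_mul_iff₀ hM0]
    have hpt : ∀ y, (n : ℝ) ^ 2 / 4 *
        (Metric.closedBall x (1 / n)).indicator (fun _ => (1 : ℝ)) y ≤ locKernel h n x y := by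
      intro y
      by_cases hy : y ∈ Metric.closedBall x (1 / (n : ℝ))
      · rw [indicator_of_mem hy, mul_one]
        rw [Metric.mem_closedBall, dist_comm] at hy
        exact le_locKernel hh hn hy
      · rw [indicator_of_notMem hy, mul_zero]
        exact locKernel_nonneg hh n x y
    refine le_trans ?_ (Finset.sum_le_sum fun j _ => hpt (xs j))
    rw [← Finset.mul_sum]
    have h2 := hbal.lower x hx
    calc (M : ℝ) * (c / 4 * ((n : ℝ) ^ 2 * (n : ℝ) ^ (-α)))
        = (n : ℝ) ^ 2 / 4 * (c * M * (n : ℝ) ^ (-α)) := by ring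
      _ ≤ _ := by gcongr; exact h2
  · have h1 := htail n hn M xs hbal.upper x R hR
    have h2 : ∀ j, {y | R ≤ n * dist x y}.indicator (fun y => locKernel h n x y) (xs j) =
        locKernel h n x (xs j) := fun j =>
      indicator_of_mem (show xs j ∈ {y | R ≤ n * dist x y} from hfar _ (hbal.mem j)) _
    simp only [h2] at h1
    unfold supportEstimator
    rw [one_div, inv_mul_le_iff₀ hM0]
    have hR0 : 0 < R := by linarith
    calc ∑ j, locKernel h n x (xs j)
        ≤ D * M * ((n : ℝ) ^ 2 * (n : ℝ) ^ (-α)) * R ^ (α - s) := h1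
      _ ≤ (D + B * A) * M * ((n : ℝ) ^ 2 * (n : ℝ) ^ (-α)) * R ^ (α - s) := by
        gcongr
        nlinarith [mul_pos hB hA]
      _ = _ := by ring

theorem le_mul_dist_of_notMem_cthickening {n : ℕ} (hn : 1 ≤ n) {R : ℝ} {x : X} {Y : Set X}
    (hx : x ∉ Metric.cthickening (R / n) Y) : ∀ y ∈ Y, R ≤ n * dist x y := by
  intro y hy
  have hn0 : (0 : ℝ) < n := by exact_mod_cast hn
  by_contra hlt
  push Not at hlt
  apply hx
  refine Metric.mem_cthickening_of_dist_le x y _ Y hy ?_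
  rw [le_div_iff₀ hn0]
  linarith

/-- For balanced samples the estimation set contains `Y` and lies in a neighborhood of `Y` of
radius of order `Θ ^ (-1 / (s - α)) / n`. -/
theorem exists_estimationSet_bounds {h : ℝ → ℝ} (hh : IsSmoothFilter h) {s α A c : ℝ}
    (hα : 0 ≤ α) (hs : α < s) (hA : 0 < A) (hc : 0 < c)
    (hd : ∀ x y : X, dist x y ≤ Real.pi) :
    ∃ C b : ℝ, 0 < C ∧ C < 1 ∧ 0 < b ∧ ∀ Θ : ℝ, 0 < Θ → Θ < C →
      ∀ n : ℕ, 1 ≤ n → ∀ M : ℕ, 1 ≤ M → ∀ (xs : Fin M → X) (Y : Set X),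
      IsBalancedSample n xs Y α A c →
        Y ⊆ estimationSet h n xs Θ ∧
        estimationSet h n xs Θ ⊆ Metric.cthickening (b * Θ ^ (-(1 / (s - α))) / n) Y := by
  obtain ⟨D, L, hD, hL, hF⟩ := exists_supportEstimator_bounds hh hα hs hA hc hd
  have hsα : 0 < s - α := by linarith
  -- Chosen so that `D b^(α-s) = D L / (D + L) < L`: at distance `b Θ^(-1/(s-α)) / n` the estimator
  -- is then strictly below `Θ` times its minimal order on the support.
  set b : ℝ := (D / L + 1) ^ (1 / (s - α)) with hb
  have hDL : 0 < D / L := by positivity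
  have hb1 : 1 ≤ b := Real.one_le_rpow (by linarith) (by positivity)
  have hb0 : 0 < b := by linarith
  have hbpow : b ^ (α - s) = (D / L + 1)⁻¹ := by
    rw [hb, ← Real.rpow_mul (by positivity),
      show 1 / (s - α) * (α - s) = -1 by field_simp; ring, Real.rpow_neg_one]
  refine ⟨min (1 / 2) (L / D), b, by positivity, (min_le_left _ _).trans_lt (by norm_num), hb0,
    fun Θ hΘ hΘC n hn M hM xs Y hbal => ?_⟩
  have hn0 : (0 : ℝ) < n := by exact_mod_cast hn
  have hN : 0 < (n : ℝ) ^ 2 * (n : ℝ) ^ (-α) := by positivity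
  have hF' := hF n hn M hM xs Y hbal
  set N := (n : ℝ) ^ 2 * (n : ℝ) ^ (-α) with hNdef
  have hΘ1 : Θ < 1 := by linarith [(lt_min_iff.mp hΘC).1]
  have hΘ2 : Θ * D ≤ L := by
    have := (lt_min_iff.mp hΘC).2
    rw [lt_div_iff₀ hD] at this
    exact this.le
  have : Nonempty (Fin M) := ⟨⟨0, hM⟩⟩
  have hsup_le : (⨆ k, supportEstimator h n xs (xs k)) ≤ D * N := ciSup_le fun k => (hF' _).1
  have hle_sup : L * N ≤ ⨆ k, supportEstimator h n xs (xs k) := by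
    let k : Fin M := ⟨0, hM⟩
    exact ((hF' (xs k)).2.1 (hbal.mem k)).trans
      (le_ciSup (f := fun k => supportEstimator h n xs (xs k)) (Set.finite_range _).bddAbove k)
  constructor
  · intro x hx
    have h1 := (hF' x).2.1 hx
    simp only [estimationSet, mem_ofPred_eq]
    calc Θ * (⨆ k, supportEstimator h n xs (xs k)) ≤ Θ * (D * N) := by gcongr
      _ = (Θ * D) * N := by ring
      _ ≤ L * N := by gcongr
      _ ≤ _ := h1
  · intro x hx
    by_contra hnot
    have hfar := le_mul_dist_of_notMem_cthickening hn hnot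
    have hΘp : 1 ≤ Θ ^ (-(1 / (s - α))) :=
      Real.one_le_rpow_of_pos_of_le_one_of_nonpos hΘ hΘ1.le
        (neg_nonpos.mpr (by positivity))
    have h1 := (hF' x).2.2 _ (one_le_mul_of_one_le_of_one_le hb1 hΘp) hfar
    simp only [estimationSet, mem_ofPred_eq] at hx
    have h2 : (b * Θ ^ (-(1 / (s - α)))) ^ (α - s) = (D / L + 1)⁻¹ * Θ := by
      rw [Real.mul_rpow hb0.le (by positivity), hbpow, ← Real.rpow_mul hΘ.le,
        show -(1 / (s - α)) * (α - s) = 1 by field_simp; ring, Real.rpow_one]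
    rw [h2] at h1
    have h3 : Θ * (L * N) ≤ D * N * ((D / L + 1)⁻¹ * Θ) :=
      le_trans (by gcongr) (hx.trans h1)
    have h4 : D * (D / L + 1)⁻¹ < L := by
      rw [← div_eq_mul_inv, div_lt_iff₀ (by positivity)]
      field_simp
      linarith
    have h5 : D * N * ((D / L + 1)⁻¹ * Θ) < Θ * (L * N) := by
      calc D * N * ((D / L + 1)⁻¹ * Θ) = (D * (D / L + 1)⁻¹) * (N * Θ) := by ring
        _ < L * (N * Θ) := by gcongr
        _ = _ := by ring
    linarith

end Metric

/-! ### Chernoff bounds for sample counts -/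

section Count

variable {X : Type*}

theorem sampleCount_mono {M : ℕ} (xs : Fin M → X) {A B : Set X} (hAB : A ⊆ B) :
    sampleCount xs A ≤ sampleCount xs B :=
  Finset.sum_le_sum fun _ _ => indicator_le_indicator_of_subset hAB (fun _ => zero_le_one) _

theorem sampleCount_le_sum {M : ℕ} (xs : Fin M → X) {A : Set X} (T : Finset X) (B : X → Set X)
    (hcov : ∀ i, xs i ∈ A → ∃ z ∈ T, xs i ∈ B z) :
    sampleCount xs A ≤ ∑ z ∈ T, sampleCount xs (B z) := by
  unfold sampleCount
  rw [Finset.sum_comm]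
  refine Finset.sum_le_sum fun i _ => ?_
  have hnn : ∀ z ∈ T, 0 ≤ (B z).indicator (fun _ => (1 : ℝ)) (xs i) := fun z _ =>
    indicator_nonneg (fun _ _ => zero_le_one) _
  by_cases hi : xs i ∈ A
  · obtain ⟨z, hz, hzi⟩ := hcov i hi
    have h1 := Finset.single_le_sum hnn hz
    rw [indicator_of_mem hzi] at h1
    rwa [indicator_of_mem hi]
  · rw [indicator_of_notMem hi]
    exact Finset.sum_nonneg hnn

theorem sampleCount_nonneg {M : ℕ} (xs : Fin M → X) (A : Set X) : 0 ≤ sampleCount xs A :=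
  Finset.sum_nonneg fun _ _ => indicator_nonneg (fun _ _ => zero_le_one) _

theorem sampleCount_le {M : ℕ} (xs : Fin M → X) (A : Set X) : sampleCount xs A ≤ M := by
  have : sampleCount xs A ≤ ∑ _i : Fin M, (1 : ℝ) :=
    Finset.sum_le_sum fun _ _ => indicator_le_self' (fun _ _ => zero_le_one) _
  simpa using this

variable [MeasurableSpace X]

theorem measurable_sampleCount {M : ℕ} {A : Set X} (hA : MeasurableSet A) :
    Measurable fun xs : Fin M → X => sampleCount xs A := by
  unfold sampleCount
  exact Finset.measurable_sum _ fun i _ =>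
    (measurable_const.indicator hA).comp (measurable_pi_apply i)

variable (μ : Measure X) [IsProbabilityMeasure μ]

theorem integrable_exp_mul_sampleCount {M : ℕ} {A : Set X} (hA : MeasurableSet A) (t : ℝ) :
    Integrable (fun xs : Fin M → X => Real.exp (t * sampleCount xs A))
      (Measure.pi fun _ : Fin M => μ) := by
  refine Integrable.of_bound
    ((measurable_sampleCount hA).const_mul t).exp.aestronglyMeasurable (Real.exp (|t| * M)) ?_
  refine Eventually.of_forall fun xs => ?_
  rw [Real.norm_eq_abs, Real.abs_exp, Real.exp_le_exp]
  have h1 := sampleCount_nonneg xs A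
  have h2 := sampleCount_le xs A
  calc t * sampleCount xs A ≤ |t| * sampleCount xs A := by gcongr; exact le_abs_self t
    _ ≤ |t| * M := by gcongr

/-- The moment generating function of a binomial count is at most that of a Poisson variable. -/
theorem mgf_sampleCount_le {M : ℕ} {A : Set X} (hA : MeasurableSet A) (t : ℝ) :
    ProbabilityTheory.mgf (fun xs : Fin M → X => sampleCount xs A)
      (Measure.pi fun _ : Fin M => μ) t ≤ Real.exp (M * (μ.real A * (Real.exp t - 1))) := by
  unfold ProbabilityTheory.mgf
  have h1 : ∀ xs : Fin M → X, Real.exp (t * sampleCount xs A) =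
      ∏ i, Real.exp (t * A.indicator (fun _ => (1 : ℝ)) (xs i)) := by
    intro xs
    rw [sampleCount, Finset.mul_sum, Real.exp_sum]
  have h2 : ∀ y, Real.exp (t * A.indicator (fun _ => (1 : ℝ)) y) =
      1 + A.indicator (fun _ => Real.exp t - 1) y := by
    intro y
    by_cases hy : y ∈ A
    · simp [hy]
    · simp [hy]
  simp only [h1]
  rw [integral_fintype_prod_eq_pow (ι := Fin M)
    (fun y => Real.exp (t * A.indicator (fun _ => (1 : ℝ)) y)), Fintype.card_fin]
  simp only [h2]
  rw [integral_add (integrable_const _) ((integrable_const _).indicator hA),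
    integral_indicator_const _ hA, Real.exp_nat_mul]
  simp only [integral_const, probReal_univ, smul_eq_mul, mul_one]
  have hint : 0 ≤ 1 + μ.real A * (Real.exp t - 1) := by
    have h3 : μ.real A ≤ 1 := measureReal_le_one
    have h4 : 0 ≤ μ.real A := measureReal_nonneg
    nlinarith [Real.exp_pos t]
  gcongr
  linarith [Real.add_one_le_exp (μ.real A * (Real.exp t - 1))]

/-- Chernoff bound at `t = 1`: since `e - 1 ≤ 2`, the exponent is at most `-3Mq + 2Mq`. -/
theorem measureReal_sampleCount_ge_le {M : ℕ} {A : Set X} (hA : MeasurableSet A) {q : ℝ}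
    (hq : μ.real A ≤ q) :
    (Measure.pi fun _ : Fin M => μ).real {xs | 3 * M * q ≤ sampleCount xs A} ≤
      Real.exp (-(M * q)) := by
  refine (ProbabilityTheory.measure_ge_le_exp_mul_mgf (t := 1) (3 * M * q) zero_le_one
    (integrable_exp_mul_sampleCount μ hA 1)).trans ?_
  refine (mul_le_mul_of_nonneg_left (mgf_sampleCount_le μ hA 1) (Real.exp_pos _).le).trans ?_
  rw [← Real.exp_add, Real.exp_le_exp]
  have h1 := Real.exp_one_lt_d9
  have h0 : 0 ≤ μ.real A := measureReal_nonneg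
  have h2 : μ.real A * (Real.exp 1 - 1) ≤ q * 2 := by
    have : 0 ≤ Real.exp 1 - 1 := by linarith [Real.add_one_le_exp (1 : ℝ)]
    have h3 : Real.exp 1 - 1 ≤ 2 := by linarith
    have h4 : 0 ≤ q := h0.trans hq
    gcongr
  have h3 : (M : ℝ) * (μ.real A * (Real.exp 1 - 1)) ≤ M * (q * 2) := by gcongr
  linarith

/-- Chernoff bound at `t = -1`: since `1 - 1/e ≥ 1/2`, the exponent is at most `Mp/4 - Mp/2`. -/
theorem measureReal_sampleCount_le_le {M : ℕ} {A : Set X} (hA : MeasurableSet A) {p : ℝ}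
    (hp : p ≤ μ.real A) :
    (Measure.pi fun _ : Fin M => μ).real {xs | sampleCount xs A ≤ M * p / 4} ≤
      Real.exp (-(M * p / 4)) := by
  refine (ProbabilityTheory.measure_le_le_exp_mul_mgf (t := -1) (M * p / 4) (by norm_num)
    (integrable_exp_mul_sampleCount μ hA (-1))).trans ?_
  refine (mul_le_mul_of_nonneg_left (mgf_sampleCount_le μ hA (-1)) (Real.exp_pos _).le).trans ?_
  rw [← Real.exp_add, Real.exp_le_exp]
  have h1 : Real.exp (-1) ≤ 1 / 2 := by
    rw [Real.exp_neg, one_div]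
    apply inv_anti₀ (by norm_num)
    linarith [Real.add_one_le_exp (1 : ℝ)]
  have h2 : p * (1 / 2) ≤ μ.real A * (1 - Real.exp (-1)) := by
    have : (1 : ℝ) / 2 ≤ 1 - Real.exp (-1) := by linarith
    gcongr
  have h3 : (M : ℝ) * (p * (1 / 2)) ≤ M * (μ.real A * (1 - Real.exp (-1))) := by gcongr
  linarith

end Count

/-! ### Nets in the support and the probability of a balanced sample -/

section Metric

variable {X : Type*} [MetricSpace X] [MeasurableSpace X] {μ : Measure X} [IsProbabilityMeasure μ]

/-- Shrinking the radius by the factor `min r₀ 1` removes the restriction to `r ≤ r₀` at the price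
of a constant, so that radii of order `1/n` are admissible for every `n ≥ 1`. -/
theorem IsDetectable.lower_of_le_one {α κ₁ κ₂ r₀ : ℝ} (hμ : IsDetectable μ α κ₁ κ₂ r₀) {x : X}
    (hx : x ∈ μ.support) {r : ℝ} (hr0 : 0 < r) (hr1 : r ≤ 1) :
    κ₂ * (min r₀ 1) ^ α * r ^ α ≤ μ.real (Metric.closedBall x r) := by
  have hr₀ := hμ.radius_pos
  have hm : 0 < min r₀ 1 := lt_min hr₀ one_pos
  have h1 := hμ.lower x hx (min r₀ 1 * r) (by positivity)
    ((mul_le_of_le_one_right hm.le hr1).trans (min_le_left _ _))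
  rw [Real.mul_rpow hm.le hr0.le, ← mul_assoc] at h1
  refine h1.trans (measureReal_mono (Metric.closedBall_subset_closedBall ?_))
  exact mul_le_of_le_one_left hr0.le (min_le_right _ _)

variable [BorelSpace X]

/-- Volume bound for separated sets in the support. -/
theorem IsDetectable.card_mul_le {α κ₁ κ₂ r₀ : ℝ} (hμ : IsDetectable μ α κ₁ κ₂ r₀)
    {δ : ℝ} (hδ0 : 0 < δ) (hδ1 : δ ≤ 1) (T : Finset X) (hT : ∀ z ∈ T, z ∈ μ.support)
    (hsep : ∀ z ∈ T, ∀ w ∈ T, z ≠ w → δ ≤ dist z w) (B : Set X)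
    (hB : ∀ z ∈ T, Metric.closedBall z δ ⊆ B) :
    (T.card : ℝ) * (κ₂ * (min r₀ 1) ^ α * (δ / 3) ^ α) ≤ μ.real B := by
  -- Radius `δ/3` rather than `δ/2`, to keep the closed balls disjoint.
  have hdisj : (T : Set X).PairwiseDisjoint (fun z => Metric.closedBall z (δ / 3)) := by
    intro z hz w hw hzw
    apply Metric.closedBall_disjoint_closedBall
    have := hsep z hz w hw hzw
    linarith
  have h1 := measureReal_biUnion_finset (μ := μ) hdisj
    (fun z _ => Metric.isClosed_closedBall.measurableSet)
  calc (T.card : ℝ) * (κ₂ * (min r₀ 1) ^ α * (δ / 3) ^ α)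
      = ∑ z ∈ T, κ₂ * (min r₀ 1) ^ α * (δ / 3) ^ α := by rw [Finset.sum_const, nsmul_eq_mul]
    _ ≤ ∑ z ∈ T, μ.real (Metric.closedBall z (δ / 3)) :=
        Finset.sum_le_sum fun z hz =>
          hμ.lower_of_le_one (hT z hz) (by positivity) (by linarith)
    _ = μ.real (⋃ z ∈ T, Metric.closedBall z (δ / 3)) := h1.symm
    _ ≤ μ.real B := by
        refine measureReal_mono (iUnion₂_subset fun z hz => ?_)
        exact (Metric.closedBall_subset_closedBall (by linarith)).trans (hB z hz)

/-- The volume bound limits the size of separated sets; one of maximal cardinality is a net, since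
an uncovered point could be added. -/
theorem IsDetectable.exists_net {α κ₁ κ₂ r₀ : ℝ} (hμ : IsDetectable μ α κ₁ κ₂ r₀)
    {δ : ℝ} (hδ0 : 0 < δ) (hδ1 : δ ≤ 1) :
    ∃ T : Finset X, (∀ z ∈ T, z ∈ μ.support) ∧
      (∀ z ∈ T, ∀ w ∈ T, z ≠ w → δ ≤ dist z w) ∧ ∀ x ∈ μ.support, ∃ z ∈ T, dist x z ≤ δ := by
  classical
  have hκ₂ := hμ.lower_pos
  have hm : 0 < min r₀ 1 := lt_min hμ.radius_pos one_pos
  let P : Finset X → Prop := fun T => (∀ z ∈ T, z ∈ μ.support) ∧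
      (∀ z ∈ T, ∀ w ∈ T, z ≠ w → δ ≤ dist z w)
  obtain ⟨N, hN⟩ := exists_nat_ge (1 / (κ₂ * (min r₀ 1) ^ α * (δ / 3) ^ α))
  have hbound : ∀ T, P T → T.card ≤ N := by
    intro T hT
    have h1 := hμ.card_mul_le hδ0 hδ1 T hT.1 hT.2 univ fun _ _ => subset_univ _
    rw [probReal_univ, ← le_div_iff₀ (by positivity)] at h1
    exact_mod_cast h1.trans hN
  let Q : ℕ → Prop := fun m => ∃ T, P T ∧ T.card = m
  have hQ0 : Q 0 := ⟨∅, by simp [P], rfl⟩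
  obtain ⟨T, hT, hcard⟩ : Q (Nat.findGreatest Q N) := Nat.findGreatest_spec (Nat.zero_le N) hQ0
  refine ⟨T, hT.1, hT.2, fun x hx => ?_⟩
  by_contra hnot
  push Not at hnot
  have hxT : x ∉ T := by
    intro hxT
    have := hnot x hxT
    rw [dist_self] at this
    linarith
  have hins : P (insert x T) := by
    constructor
    · intro z hz
      rcases Finset.mem_insert.mp hz with rfl | hz
      · exact hx
      · exact hT.1 z hz
    · intro z hz w hw hzw
      rcases Finset.mem_insert.mp hz with h1 | h1 <;> rcases Finset.mem_insert.mp hw with h2 | h2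
      · exact absurd (h1.trans h2.symm) hzw
      · rw [h1]
        exact (hnot w h2).le
      · rw [h2, dist_comm]
        exact (hnot z h1).le
      · exact hT.2 z h1 w h2 hzw
  have h1 := Nat.le_findGreatest (P := Q) (hbound _ hins) ⟨_, hins, rfl⟩
  rw [Finset.card_insert_of_notMem hxT] at h1
  omega

/-- Control of the counts in the balls of a net suffices for a balanced sample. -/
theorem IsDetectable.isBalancedSample {α κ₁ κ₂ r₀ : ℝ} (hμ : IsDetectable μ α κ₁ κ₂ r₀)
    {n : ℕ} (hn : 1 ≤ n) {T : Finset X} (hT : ∀ z ∈ T, z ∈ μ.support)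
    (hsep : ∀ z ∈ T, ∀ w ∈ T, z ≠ w → 1 / (2 * (n : ℝ)) ≤ dist z w)
    (hcov : ∀ x ∈ μ.support, ∃ z ∈ T, dist x z ≤ 1 / (2 * (n : ℝ)))
    {M : ℕ} {xs : Fin M → X} (hmem : ∀ i, xs i ∈ μ.support)
    (hcount : ∀ z ∈ T,
      M * (κ₂ * (min r₀ 1) ^ α * (1 / (2 * (n : ℝ))) ^ α) / 4 ≤
        sampleCount xs (Metric.closedBall z (1 / (2 * (n : ℝ)))) ∧
      sampleCount xs (Metric.closedBall z (1 / (2 * (n : ℝ)))) ≤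
        3 * M * (κ₁ * (1 / (2 * (n : ℝ))) ^ α)) :
    IsBalancedSample n xs μ.support α (3 * κ₁ ^ 2 * 6 ^ α / (κ₂ * (min r₀ 1) ^ α))
      (κ₂ * (min r₀ 1) ^ α / (4 * 2 ^ α)) := by
  classical
  have hn0 : (0 : ℝ) < n := by exact_mod_cast hn
  have hn1 : (1 : ℝ) ≤ n := by exact_mod_cast hn
  have hα := hμ.exponent_nonneg
  have hκ₁ := hμ.upper_pos
  have hκ₂ := hμ.lower_pos
  have hm : 0 < min r₀ 1 := lt_min hμ.radius_pos one_pos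
  set κ := κ₂ * (min r₀ 1) ^ α with hκ
  have hκ0 : 0 < κ := by positivity
  set δ := 1 / (2 * (n : ℝ)) with hδ
  have hδ0 : 0 < δ := by positivity
  have hδ1 : δ ≤ 1 := by
    rw [hδ, div_le_one (by positivity)]
    linarith
  have hδn : 2 * δ = 1 / n := by
    rw [hδ]
    field_simp
  refine ⟨hmem, fun x ρ hρ => ?_, fun x hx => ?_⟩
  · rw [← hδn] at hρ
    have hρ0 : 0 < ρ := by linarith
    -- These net points cover the samples in the ball, and their `δ`-balls lie in the ball of radius
    -- `2ρ` because `2δ = 1/n ≤ ρ`; the upper mass bound there limits their number.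
    set T' := T.filter (fun z => dist z x ≤ ρ + δ) with hT'
    have hT'T : ∀ z ∈ T', z ∈ T ∧ dist z x ≤ ρ + δ := fun z hz => Finset.mem_filter.mp hz
    have h1 : sampleCount xs (Metric.closedBall x ρ) ≤
        ∑ z ∈ T', sampleCount xs (Metric.closedBall z δ) := by
      refine sampleCount_le_sum xs T' (fun z => Metric.closedBall z δ) fun i hi => ?_
      obtain ⟨z, hz, hdz⟩ := hcov _ (hmem i)
      refine ⟨z, Finset.mem_filter.mpr ⟨hz, ?_⟩, hdz⟩
      have h2 := dist_triangle_left z x (xs i)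
      rw [Metric.mem_closedBall] at hi
      linarith
    have h2 : ∑ z ∈ T', sampleCount xs (Metric.closedBall z δ) ≤
        T'.card * (3 * M * (κ₁ * δ ^ α)) := by
      rw [← nsmul_eq_mul]
      exact Finset.sum_le_card_nsmul _ _ _ fun z hz => (hcount z (hT'T z hz).1).2
    have h3 : (T'.card : ℝ) * (κ * (δ / 3) ^ α) ≤ κ₁ * (2 * ρ) ^ α := by
      refine (hμ.card_mul_le hδ0 hδ1 T' (fun z hz => hT z (hT'T z hz).1)
        (fun z hz w hw => hsep z (hT'T z hz).1 w (hT'T w hw).1)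
        (Metric.closedBall x (2 * ρ)) fun z hz => ?_).trans (hμ.upper x _ (by positivity))
      apply Metric.closedBall_subset_closedBall'
      linarith [(hT'T z hz).2]
    refine (h1.trans h2).trans ?_
    rw [Real.div_rpow hδ0.le (by norm_num), Real.mul_rpow (by norm_num) hρ0.le] at h3
    have h6 : (6 : ℝ) ^ α = 2 ^ α * 3 ^ α := by
      rw [← Real.mul_rpow (by norm_num) (by norm_num)]
      norm_num
    have h7 : (T'.card : ℝ) * δ ^ α ≤ κ₁ * (2 ^ α * ρ ^ α) * 3 ^ α / κ := by
      rw [le_div_iff₀ hκ0]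
      have h3pos : (0 : ℝ) < 3 ^ α := by positivity
      calc (T'.card : ℝ) * δ ^ α * κ = T'.card * (κ * (δ ^ α / 3 ^ α)) * 3 ^ α := by
            field_simp
        _ ≤ _ := by gcongr
    calc (T'.card : ℝ) * (3 * M * (κ₁ * δ ^ α)) = (3 * M * κ₁) * (T'.card * δ ^ α) := by ring
      _ ≤ (3 * M * κ₁) * (κ₁ * (2 ^ α * ρ ^ α) * 3 ^ α / κ) := by gcongr
      _ = _ := by
        rw [h6]
        ring
  · obtain ⟨z, hz, hdz⟩ := hcov x hx
    refine le_trans (le_of_eq ?_) ((hcount z hz).1.trans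
      (sampleCount_mono xs (Metric.closedBall_subset_closedBall' ?_)))
    · rw [hδ, one_div, Real.inv_rpow (by positivity), Real.mul_rpow (by norm_num) hn0.le,
        Real.rpow_neg hn0.le]
      field_simp
    · rw [← hδn, dist_comm]
      linarith

/-- A sample of size at least `c n ^ α log n` is balanced with high probability. -/
theorem exists_event_isBalancedSample [SecondCountableTopology X] {α κ₁ κ₂ r₀ : ℝ} (hα : 0 ≤ α)
    (hκ₁ : 0 < κ₁) (hκ₂ : 0 < κ₂) (hr₀ : 0 < r₀) :
    ∃ A c cM c₁ : ℝ, 0 < A ∧ 0 < c ∧ 0 < cM ∧ 0 < c₁ ∧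
      ∀ (μ : Measure X) [IsProbabilityMeasure μ], IsDetectable μ α κ₁ κ₂ r₀ →
      ∀ n M : ℕ, 1 ≤ n → 1 ≤ M → cM * (n : ℝ) ^ α * Real.log n ≤ M →
      ∃ E : Set (Fin M → X), MeasurableSet E ∧
        1 - c₁ / (M : ℝ) ≤ (Measure.pi (fun _ : Fin M => μ)).real E ∧
        ∀ xs ∈ E, IsBalancedSample n xs μ.support α A c := by
  have hm : 0 < min r₀ 1 := lt_min hr₀ one_pos
  set κ := κ₂ * (min r₀ 1) ^ α with hκ
  have hκ0 : 0 < κ := by positivity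
  set γ := κ / (4 * 2 ^ α) with hγ
  have hγ0 : 0 < γ := by positivity
  -- In `cM` the term `4α/γ` makes half of the Chernoff exponent beat `n^(2α)`, and `+ 1` keeps it
  -- positive for `α = 0`. In `c₁` the factors are the net size over `n^α`, the two tails, and the
  -- `2/γ` from the other half of the exponent.
  refine ⟨3 * κ₁ ^ 2 * 6 ^ α / κ, γ, 4 * α / γ + 1, 6 ^ α / κ * 2 * (2 / γ),
    by positivity, by positivity, by positivity, by positivity,
    fun μ _ hμ n M hn hM hnM => ?_⟩
  have hn0 : (0 : ℝ) < n := by exact_mod_cast hn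
  have hn1 : (1 : ℝ) ≤ n := by exact_mod_cast hn
  have hM0 : (0 : ℝ) < M := by exact_mod_cast hM
  set δ := 1 / (2 * (n : ℝ)) with hδ
  have hδ0 : 0 < δ := by positivity
  have hδ1 : δ ≤ 1 := by
    rw [hδ, div_le_one (by positivity)]
    linarith
  obtain ⟨T, hT, hsep, hcov⟩ := hμ.exists_net hδ0 hδ1
  set p := κ * δ ^ α with hp
  set q := κ₁ * δ ^ α with hq
  let bad : X → Set (Fin M → X) := fun z =>
    {xs | sampleCount xs (Metric.closedBall z δ) ≤ M * p / 4} ∪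
      {xs | 3 * M * q ≤ sampleCount xs (Metric.closedBall z δ)}
  -- Samples with a point off the support form a null set; discarding them gives the membership
  -- clause of a balanced sample.
  let out : Set (Fin M → X) := ⋃ i, (fun xs => xs i) ⁻¹' μ.supportᶜ
  have hcl : ∀ z : X, MeasurableSet (Metric.closedBall z δ) := fun z =>
    Metric.isClosed_closedBall.measurableSet
  have hbad : ∀ z, MeasurableSet (bad z) := fun z =>
    (measurableSet_le (measurable_sampleCount (hcl z)) measurable_const).union
      (measurableSet_le measurable_const (measurable_sampleCount (hcl z)))
  have hout : MeasurableSet out := MeasurableSet.iUnion fun i =>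
    measurable_pi_apply i Measure.isClosed_support.measurableSet.compl
  have hout0 : (Measure.pi fun _ : Fin M => μ) out = 0 := by
    refine measure_iUnion_null fun i => ?_
    exact (measurePreserving_eval (fun _ : Fin M => μ) i).measure_preimage
      Measure.isClosed_support.measurableSet.compl.nullMeasurableSet |>.trans
      Measure.measure_compl_support
  have hEm : MeasurableSet (out ∪ ⋃ z ∈ T, bad z) :=
    hout.union (Finset.measurableSet_biUnion T fun z _ => hbad z)
  have hbadle : ∀ z ∈ T, (Measure.pi fun _ : Fin M => μ).real (bad z) ≤
      2 * Real.exp (-(M * p / 4)) := by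
    intro z hz
    have hlow : p ≤ μ.real (Metric.closedBall z δ) := hμ.lower_of_le_one (hT z hz) hδ0 hδ1
    have hup : μ.real (Metric.closedBall z δ) ≤ q := hμ.upper z δ hδ0
    refine (measureReal_union_le _ _).trans ?_
    have h1 := measureReal_sampleCount_le_le μ (M := M) (hcl z) hlow
    have h2 := measureReal_sampleCount_ge_le μ (M := M) (hcl z) hup
    have h3 : Real.exp (-(M * q)) ≤ Real.exp (-(M * p / 4)) := by
      rw [Real.exp_le_exp]
      have : (M : ℝ) * p ≤ M * q := by
        gcongr
        exact hlow.trans hup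
      have : 0 ≤ (M : ℝ) * p := by positivity
      linarith
    linarith
  refine ⟨(out ∪ ⋃ z ∈ T, bad z)ᶜ, hEm.compl, ?_, fun xs hxs => ?_⟩
  · rw [probReal_compl_eq_one_sub hEm]
    have h1 : (Measure.pi fun _ : Fin M => μ).real (out ∪ ⋃ z ∈ T, bad z) ≤
        T.card * (2 * Real.exp (-(M * p / 4))) := by
      refine (measureReal_union_le _ _).trans ?_
      rw [show (Measure.pi fun _ : Fin M => μ).real out = 0 by simp [measureReal_def, hout0],
        zero_add]
      refine (measureReal_biUnion_finset_le T bad).trans ?_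
      rw [← nsmul_eq_mul]
      exact Finset.sum_le_card_nsmul _ _ _ hbadle
    have hcard := hμ.card_mul_le hδ0 hδ1 T hT hsep univ fun _ _ => subset_univ _
    rw [probReal_univ, ← le_div_iff₀ (by positivity)] at hcard
    have hδ3 : (δ / 3) ^ α = (6 ^ α * (n : ℝ) ^ α)⁻¹ := by
      rw [← Real.mul_rpow (by norm_num) hn0.le, ← Real.inv_rpow (by positivity), hδ]
      congr 1
      field_simp
      norm_num
    have hcard' : (T.card : ℝ) ≤ 6 ^ α / κ * (n : ℝ) ^ α := by
      refine hcard.trans (le_of_eq ?_)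
      rw [hδ3, ← hκ]
      field_simp
    set t := (M : ℝ) / (n : ℝ) ^ α with ht
    have ht0 : 0 < t := by positivity
    have hpt : (M : ℝ) * p / 4 = γ * t := by
      rw [hp, hγ, ht, hδ, one_div, Real.inv_rpow (by positivity),
        Real.mul_rpow (by norm_num) hn0.le]
      field_simp
    have hlog0 : 0 ≤ Real.log n := Real.log_nonneg hn1
    have hlog : (4 * α / γ + 1) * Real.log n ≤ t := by
      rw [ht, le_div_iff₀ (by positivity)]
      linarith
    have hnexp : (n : ℝ) ^ α * (n : ℝ) ^ α ≤ Real.exp (γ * t / 2) := by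
      rw [Real.rpow_def_of_pos hn0, ← Real.exp_add, Real.exp_le_exp]
      have h2 : 4 * α / γ * Real.log n ≤ t := by nlinarith
      have h3 : γ * (4 * α / γ * Real.log n) ≤ γ * t := by gcongr
      have h4 : γ * (4 * α / γ * Real.log n) = 4 * α * Real.log n := by field_simp
      linarith
    have hexp2 : γ * t / 2 ≤ Real.exp (γ * t / 2) := by
      linarith [Real.add_one_le_exp (γ * t / 2)]
    have hfin : (n : ℝ) ^ α * Real.exp (-(γ * t)) ≤ (2 / γ) / M := by
      have e1 : Real.exp (-(γ * t)) =
          (Real.exp (γ * t / 2))⁻¹ * (Real.exp (γ * t / 2))⁻¹ := by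
        rw [← Real.exp_neg, ← Real.exp_add]
        ring_nf
      have hMt : (M : ℝ) = t * (n : ℝ) ^ α := by
        rw [ht]
        field_simp
      have hna : 0 < (n : ℝ) ^ α := by positivity
      have hu : 0 < γ * t / 2 := by positivity
      calc (n : ℝ) ^ α * Real.exp (-(γ * t))
          = (n : ℝ) ^ α * ((Real.exp (γ * t / 2))⁻¹ * (Real.exp (γ * t / 2))⁻¹) := by rw [e1]
        _ ≤ (n : ℝ) ^ α * (((n : ℝ) ^ α * (n : ℝ) ^ α)⁻¹ * (γ * t / 2)⁻¹) := by gcongr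
        _ = (2 / γ) / M := by
          rw [hMt]
          field_simp
    rw [hpt] at h1
    have hfinal : (T.card : ℝ) * (2 * Real.exp (-(γ * t))) ≤
        6 ^ α / κ * 2 * (2 / γ) / M := by
      calc (T.card : ℝ) * (2 * Real.exp (-(γ * t)))
          ≤ (6 ^ α / κ * (n : ℝ) ^ α) * (2 * Real.exp (-(γ * t))) := by gcongr
        _ = 6 ^ α / κ * 2 * ((n : ℝ) ^ α * Real.exp (-(γ * t))) := by ring
        _ ≤ 6 ^ α / κ * 2 * ((2 / γ) / M) := by gcongr
        _ = _ := by ring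
    linarith
  · simp only [mem_compl_iff, mem_union, not_or, out, bad, mem_iUnion, not_exists] at hxs
    refine hμ.isBalancedSample hn hT hsep hcov (fun i => ?_) fun z hz => ?_
    · by_contra hi
      exact hxs.1 i hi
    · have h1 := hxs.2 z hz
      exact ⟨(not_le.mp h1.1).le, (not_le.mp h1.2).le⟩

end Metric

/-! ### Separation of neighborhoods and the light exceptional set -/

section Metric

variable {X : Type*} [MetricSpace X]

/-- Triangle inequality `2η - 2ρ ≥ η`. The distance to a set need not be attained, hence the slack
`ε` and the passage to open neighborhoods. -/
theorem DistGE.cthickening {A B : Set X} {η ρ : ℝ} (hAB : DistGE (2 * η) A B) (hρ0 : 0 < ρ)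
    (hρ : ρ ≤ η / 2) : DistGE η (Metric.cthickening ρ A) (Metric.cthickening ρ B) := by
  intro x hx y hy
  refine le_of_forall_pos_le_add fun ε hε => ?_
  have hlt : ρ < ρ + ε / 2 := by linarith
  obtain ⟨a, ha, hxa⟩ := Metric.mem_thickening_iff.mp
    (Metric.cthickening_subset_thickening' (by linarith) hlt A hx)
  obtain ⟨b, hb, hyb⟩ := Metric.mem_thickening_iff.mp
    (Metric.cthickening_subset_thickening' (by linarith) hlt B hy)
  have h1 := hAB a ha b hb
  have h2 := dist_triangle4 a x y b
  rw [dist_comm a x] at h2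
  linarith

/-- Supplies the measurability of the clusters needed to add up their masses. -/
theorem isClosed_estimationPiece (h : ℝ → ℝ) (n : ℕ) {M : ℕ} (xs : Fin M → X) (Θ r : ℝ)
    (A : Set X) : IsClosed (estimationPiece h n xs Θ r A) := by
  refine IsClosed.inter ?_ Metric.isClosed_cthickening
  refine isClosed_le continuous_const ?_
  unfold supportEstimator
  exact continuous_const.mul
    (continuous_finsetSum _ fun j _ => continuous_locKernel_left h n (xs j))

variable [MeasurableSpace X] {μ : Measure X} [IsProbabilityMeasure μ]

/-- If the exceptional set of a partition of the support has smaller mass than the balls of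
radius `δ`, then every point of the support is within `δ` of one of the other sets. -/
theorem exists_mem_dist_le_of_measureReal_lt [SecondCountableTopology X] {K : ℕ}
    {S : Fin (K + 1) → Set X} (hS : (⋃ i, S i) = μ.support) {y : X} {δ : ℝ}
    (hy : μ.real (S (Fin.last K)) < μ.real (Metric.closedBall y δ)) :
    ∃ k : Fin K, ∃ z ∈ S k.castSucc, dist z y ≤ δ := by
  by_contra hnot
  push Not at hnot
  have hsub : Metric.closedBall y δ ⊆ S (Fin.last K) ∪ μ.supportᶜ := by
    intro z hz
    by_cases hzs : z ∈ μ.support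
    · rw [← hS] at hzs
      obtain ⟨i, hi⟩ := mem_iUnion.mp hzs
      induction i using Fin.lastCases with
      | last => exact Or.inl hi
      | cast k => exact absurd hz (not_le.mpr (hnot k z hi))
    · exact Or.inr hzs
  have h1 : μ.real (Metric.closedBall y δ) ≤ μ.real (S (Fin.last K)) + μ.real μ.supportᶜ :=
    (measureReal_mono hsub).trans (measureReal_union_le _ _)
  rw [show μ.real μ.supportᶜ = 0 by simp [measureReal_def, Measure.measure_compl_support]] at h1
  linarith

end Metric

/-! ### Bounds for the F-score -/

section FScore

variable {X : Type*} [MeasurableSpace X] {K : ℕ}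

theorem clusterFScore_nonneg (μ : Measure X) (L : Fin K → Set X) (C : Set X) :
    0 ≤ clusterFScore μ L C := by
  refine mul_nonneg zero_le_two (Real.iSup_nonneg fun k => ?_)
  positivity

variable {μ : Measure X} [IsProbabilityMeasure μ]

theorem clusterFScore_le_one (L : Fin K → Set X) (C : Set X) : clusterFScore μ L C ≤ 1 := by
  have : (⨆ k, μ.real (C ∩ L k) / (μ.real C + μ.real (L k))) ≤ 1 / 2 := by
    refine Real.iSup_le (fun k => ?_) (by norm_num)
    refine div_le_of_le_mul₀ (by positivity) (by norm_num) ?_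
    have h1 : μ.real (C ∩ L k) ≤ μ.real C := measureReal_mono inter_subset_left
    have h2 : μ.real (C ∩ L k) ≤ μ.real (L k) := measureReal_mono inter_subset_right
    linarith
  unfold clusterFScore
  linarith

theorem sum_measureReal_eq_one {C : Fin K → Set X} (hC : ∀ k, MeasurableSet (C k))
    (hdisj : Pairwise fun i j => Disjoint (C i) (C j)) (hfull : μ.real (⋃ k, C k) = 1) :
    ∑ k, μ.real (C k) = 1 := by
  rw [← hfull]
  exact (measureReal_iUnion_fintype hdisj hC).symm

/-- Crude bound for those `η` at which the mass ratio is infinite. -/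
theorem abs_fScore_sub_one_le_one {C : Fin K → Set X} (hC : ∀ k, MeasurableSet (C k))
    (hdisj : Pairwise fun i j => Disjoint (C i) (C j)) (hfull : μ.real (⋃ k, C k) = 1)
    (L : Fin K → Set X) : |fScore μ L C - 1| ≤ 1 := by
  have hsum := sum_measureReal_eq_one hC hdisj hfull
  unfold fScore
  rw [hfull, div_one]
  have h0 : 0 ≤ ∑ j, μ.real (C j) * clusterFScore μ L (C j) :=
    Finset.sum_nonneg fun j _ => mul_nonneg measureReal_nonneg (clusterFScore_nonneg μ L (C j))
  have h1 : ∑ j, μ.real (C j) * clusterFScore μ L (C j) ≤ ∑ j, μ.real (C j) :=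
    Finset.sum_le_sum fun j _ =>
      mul_le_of_le_one_right measureReal_nonneg (clusterFScore_le_one L (C j))
  rw [abs_le]
  constructor <;> linarith

/-- Disjoint clusters `C k ⊇ L k` covering almost everything have an F-score within `q` of `1` if
the mass not covered by the `L k` is at most `q` times that of each `L k`. -/
theorem abs_fScore_sub_one_le {C : Fin K → Set X} (hC : ∀ k, MeasurableSet (C k))
    (hdisj : Pairwise fun i j => Disjoint (C i) (C j)) (hfull : μ.real (⋃ k, C k) = 1)
    {L : Fin K → Set X} (hLC : ∀ k, L k ⊆ C k) {q m : ℝ} (hq : 0 ≤ q)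
    (hm : μ.real (⋃ k, L k)ᶜ ≤ m) (hmq : ∀ k, m ≤ q * μ.real (L k)) :
    |fScore μ L C - 1| ≤ q := by
  have hsum := sum_measureReal_eq_one hC hdisj hfull
  have hterm : ∀ j, μ.real (C j) * (1 - q) ≤ μ.real (C j) * clusterFScore μ L (C j) := by
    intro j
    have hsub : C j ⊆ L j ∪ (⋃ k, L k)ᶜ := by
      intro x hx
      by_cases hxL : x ∈ ⋃ k, L k
      · obtain ⟨k, hk⟩ := mem_iUnion.mp hxL
        rcases eq_or_ne j k with rfl | hjk
        · exact Or.inl hk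
        · exact absurd (hLC k hk) (disjoint_left.mp (hdisj hjk) hx)
      · exact Or.inr hxL
    have hle : μ.real (C j) ≤ μ.real (L j) + m :=
      ((measureReal_mono hsub).trans (measureReal_union_le _ _)).trans (by linarith)
    -- Clusters of mass zero carry no weight; otherwise the denominator of the score is positive.
    rcases (measureReal_nonneg (μ := μ) (s := C j)).eq_or_lt with h0 | h0
    · rw [← h0, zero_mul, zero_mul]
    · refine mul_le_mul_of_nonneg_left ?_ h0.le
      have hs0 : 0 ≤ μ.real (L j) := measureReal_nonneg
      have h1 : μ.real (L j) / (μ.real (C j) + μ.real (L j)) ≤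
          ⨆ k, μ.real (C j ∩ L k) / (μ.real (C j) + μ.real (L k)) := by
        have := le_ciSup
          (f := fun k => μ.real (C j ∩ L k) / (μ.real (C j) + μ.real (L k)))
          (Set.finite_range _).bddAbove j
        rwa [inter_eq_self_of_subset_right (hLC j)] at this
      have h2 : 1 - q ≤ 2 * (μ.real (L j) / (μ.real (C j) + μ.real (L j))) := by
        rw [← mul_div_assoc, le_div_iff₀ (by positivity)]
        -- Only `q ≤ 1` has content: there `(1 - q)(2 + q) = 2 - q - q² ≤ 2`.
        rcases le_total 1 q with hq1 | hq1
        · have : (1 - q) * (μ.real (C j) + μ.real (L j)) ≤ 0 :=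
            mul_nonpos_of_nonpos_of_nonneg (by linarith) (by positivity)
          linarith
        · have h3 : μ.real (C j) + μ.real (L j) ≤ (2 + q) * μ.real (L j) := by
            linarith [hmq j]
          have h4 : (1 - q) * (μ.real (C j) + μ.real (L j)) ≤
              (1 - q) * ((2 + q) * μ.real (L j)) :=
            mul_le_mul_of_nonneg_left h3 (by linarith)
          nlinarith [mul_nonneg hq hs0, mul_nonneg (mul_nonneg hq hq) hs0]
      unfold clusterFScore
      linarith
  have hlow : 1 - q ≤ ∑ j, μ.real (C j) * clusterFScore μ L (C j) := by
    calc 1 - q = ∑ j, μ.real (C j) * (1 - q) := by rw [← Finset.sum_mul, hsum, one_mul]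
      _ ≤ _ := Finset.sum_le_sum fun j _ => hterm j
  have hup : ∑ j, μ.real (C j) * clusterFScore μ L (C j) ≤ ∑ j, μ.real (C j) :=
    Finset.sum_le_sum fun j _ =>
      mul_le_of_le_one_right measureReal_nonneg (clusterFScore_le_one L (C j))
  unfold fScore
  rw [hfull, div_one, abs_le]
  constructor <;> linarith

end FScore

/-! ### Partition of the estimation set -/

section Partition

variable {X : Type*} [MetricSpace X] [CompactSpace X] [MeasurableSpace X]
  {μ : Measure X} [IsProbabilityMeasure μ]

/-- The pieces of the estimation set separate along the fine structure. -/
theorem estimationPiece_isPartition {h : ℝ → ℝ} {n M : ℕ} {xs : Fin M → X} {Θ R r η : ℝ} {K : ℕ}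
    {S : Fin (K + 1) → Set X} (hn : 1 ≤ n) (hS : (⋃ i, S i) = μ.support)
    (hsep : ∀ j k : Fin K, j ≠ k → DistGE (2 * η) (S j.castSucc) (S k.castSucc)) (hη : 0 < η)
    (hR : 0 ≤ R) (hRr : R + 1 ≤ r) (hrη : r / n ≤ η / 2)
    (hG : estimationSet h n xs Θ ⊆ Metric.cthickening (R / n) μ.support)
    (hball : ∀ y ∈ μ.support,
      μ.real (S (Fin.last K)) < μ.real (Metric.closedBall y (1 / (n : ℝ)))) :
    IsPartition (fun k : Fin K => estimationPiece h n xs Θ r (S k.castSucc))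
        (estimationSet h n xs Θ) ∧
      ∀ j k : Fin K, j ≠ k → DistGE η (estimationPiece h n xs Θ r (S j.castSucc))
        (estimationPiece h n xs Θ r (S k.castSucc)) := by
  have hn0 : (0 : ℝ) < n := by exact_mod_cast hn
  have hdist : ∀ j k : Fin K, j ≠ k → DistGE η (estimationPiece h n xs Θ r (S j.castSucc))
      (estimationPiece h n xs Θ r (S k.castSucc)) := fun j k hjk x hx y hy =>
    (hsep j k hjk).cthickening (div_pos (by linarith) hn0) hrη x hx.2 y hy.2
  refine ⟨⟨Subset.antisymm (iUnion_subset fun k => inter_subset_left) fun x hx => ?_,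
    fun j k hjk => ?_⟩, hdist⟩
  · have hx1 := hG hx
    -- Compactness of the support provides a point of it at distance at most `R/n`; the additional
    -- `1` in `r ≥ R + 1` pays for moving on to a main piece.
    rw [Measure.isClosed_support.isCompact.cthickening_eq_biUnion_closedBall (by positivity)] at hx1
    obtain ⟨y, hy, hxy⟩ := mem_iUnion₂.mp hx1
    obtain ⟨k, z, hz, hzy⟩ := exists_mem_dist_le_of_measureReal_lt hS (hball y hy)
    refine mem_iUnion.mpr ⟨k, hx, Metric.mem_cthickening_of_dist_le x z _ _ hz ?_⟩
    rw [Metric.mem_closedBall] at hxy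
    calc dist x z ≤ dist x y + dist z y := dist_triangle_right x z y
      _ ≤ R / n + 1 / n := by gcongr
      _ = (R + 1) / n := by ring
      _ ≤ r / n := by gcongr
  · refine disjoint_left.mpr ?_
    intro x hx hx'
    have := hdist j k hjk x hx x hx'
    rw [dist_self] at this
    linarith

end Partition

end SupportEstimation

/-! ### Choice of the constants and conclusion -/

theorem theorem3 {X : Type*} [MetricSpace X] [CompactSpace X] [MeasurableSpace X] [BorelSpace X]
    (hdiam : Metric.diam (Set.univ : Set X) = Real.pi)
    (h : ℝ → ℝ) (hh : SupportEstimation.IsSmoothFilter h)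
    (s α κ₁ κ₂ r₀ : ℝ) (hs : α < s) :
    -- the constants; `cM`, `cn`, `cS` are the implied constants in the conditions on `M`, `n` and
    -- on the measure of the exceptional set, `a`, `b` those in `r(Θ) ∼ Θ^{-1/(s-α)}`
    ∃ C cM cn cS c₁ c₂ a b : ℝ, 0 < C ∧ C < 1 ∧ 0 < cM ∧ 0 < cn ∧ 0 < cS ∧ 0 < c₁ ∧ 0 < c₂ ∧
      0 < a ∧ 0 < b ∧
    ∃ r : ℝ → ℝ,
      (∀ Θ : ℝ, 0 < Θ → Θ < C →
        a * Θ ^ (-(1 / (s - α))) ≤ r Θ ∧ r Θ ≤ b * Θ ^ (-(1 / (s - α)))) ∧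
    ∀ (μ : MeasureTheory.Measure X) [MeasureTheory.IsProbabilityMeasure μ],
      SupportEstimation.IsDetectable μ α κ₁ κ₂ r₀ →
    ∀ (η₀ : ℝ) (K : ℝ → ℕ) (S : (η : ℝ) → Fin (K η + 1) → Set X),
      SupportEstimation.IsFineStructure μ η₀ K S →
      Tendsto (fun η => ⨆ k : Fin (K η), μ (S η (Fin.last (K η))) / μ (S η k.castSucc))
        (𝓝[>] 0) (𝓝 0) →
    ∃ ε : ℝ → ℝ, Tendsto ε (𝓝[>] 0) (𝓝 0) ∧
    ∀ (Θ : ℝ) (n M : ℕ), 0 < Θ → Θ < C → 1 ≤ n → 1 ≤ M →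
      cM * (n : ℝ) ^ α * Real.log n ≤ M →
    -- an event of probability at least `1 - c₁ / M ^ c₂` for `M` independent samples from `μ`
    ∃ E : Set (Fin M → X), MeasurableSet E ∧
      1 - c₁ / (M : ℝ) ^ c₂ ≤ (MeasureTheory.Measure.pi (fun _ : Fin M => μ)).real E ∧
    ∀ xs ∈ E,
      -- `r(Θ)` is a radius at which the support is estimated
      (μ.support ⊆ SupportEstimation.estimationSet h n xs Θ ∧
        SupportEstimation.estimationSet h n xs Θ ⊆
          Metric.cthickening (r Θ / (n : ℝ)) μ.support) ∧
      ∀ η : ℝ, 0 < η → η ≤ η₀ →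
        cn / (η * Θ ^ (1 / (s - α))) ≤ n →
        μ.real (S η (Fin.last (K η))) ≤ cS * Θ * (n : ℝ) ^ (-α) →
        -- the pieces form a partition of the estimation set with separation `η`
        (SupportEstimation.IsPartition
            (fun k : Fin (K η) => SupportEstimation.estimationPiece h n xs Θ (r Θ) (S η k.castSucc))
            (SupportEstimation.estimationSet h n xs Θ) ∧
          ∀ j k : Fin (K η), j ≠ k → SupportEstimation.DistGE η
            (SupportEstimation.estimationPiece h n xs Θ (r Θ) (S η j.castSucc))
            (SupportEstimation.estimationPiece h n xs Θ (r Θ) (S η k.castSucc))) ∧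
        -- and their F-score against the true pieces tends to `1` as `η → 0⁺`
        |SupportEstimation.fScore μ (fun k : Fin (K η) => S η k.castSucc)
            (fun k : Fin (K η) =>
              SupportEstimation.estimationPiece h n xs Θ (r Θ) (S η k.castSucc)) - 1| ≤ ε η := by
  classical
  have hd : ∀ x y : X, dist x y ≤ Real.pi := fun x y => by
    rw [← hdiam]
    exact Metric.dist_le_diam_of_mem isCompact_univ.isBounded (mem_univ x) (mem_univ y)
  -- Detectability includes these sign conditions; if they fail, no measure is detectable and any
  -- constants will do.
  by_cases hpar : 0 ≤ α ∧ 0 < κ₁ ∧ 0 < κ₂ ∧ 0 < r₀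
  swap
  · refine ⟨1 / 2, 1, 1, 1, 1, 1, 1, 1, by norm_num, by norm_num, one_pos, one_pos, one_pos,
      one_pos, one_pos, one_pos, one_pos, fun Θ => Θ ^ (-(1 / (s - α))),
      fun Θ _ _ => ⟨(one_mul _).le, (one_mul _).ge⟩, fun μ _ hμ => ?_⟩
    exact absurd ⟨hμ.exponent_nonneg, hμ.upper_pos, hμ.lower_pos, hμ.radius_pos⟩ hpar
  obtain ⟨hα, hκ₁, hκ₂, hr₀⟩ := hpar
  have hm : 0 < min r₀ 1 := lt_min hr₀ one_pos
  have hsα : 0 < s - α := by linarith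
  obtain ⟨A, c, cM, c₁, hA, hc, hcM, hc₁, hevent⟩ :=
    SupportEstimation.exists_event_isBalancedSample (X := X) hα hκ₁ hκ₂ hr₀
  obtain ⟨C, b, hC0, hC1, hb, hest⟩ :=
    SupportEstimation.exists_estimationSet_bounds hh hα hs hA hc hd
  -- `cn = 2(b + 1)` amounts to `r(Θ)/n ≤ η/2`, and `cS` is the constant in the lower mass bound for
  -- `1/n`-balls. Taking `b + 1` in `r(Θ)` leaves the margin `Θ^(-1/(s-α)) ≥ 1` over the radius of
  -- the estimation set.
  refine ⟨C, cM, 2 * (b + 1), κ₂ * (min r₀ 1) ^ α, c₁, 1, b + 1, b + 1, hC0, hC1, hcM,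
    by positivity, by positivity, hc₁, one_pos, by positivity, by positivity,
    fun Θ => (b + 1) * Θ ^ (-(1 / (s - α))), fun Θ _ _ => ⟨le_rfl, le_rfl⟩,
    fun μ _ hμ η₀ K S hS hlim => ?_⟩
  set Q : ℝ → ENNReal :=
    fun η => ⨆ k : Fin (K η), μ (S η (Fin.last (K η))) / μ (S η k.castSucc) with hQ
  -- `toReal` sends `⊤` to `0`, which would be no bound, so the value `1` is used there; by the
  -- limit hypothesis this does not occur for small `η`.
  refine ⟨fun η => if Q η = ⊤ then 1 else (Q η).toReal, ?_, fun Θ n M hΘ hΘC hn hM hnM => ?_⟩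
  · have h1 : Tendsto (fun η => (Q η).toReal) (𝓝[>] 0) (𝓝 0) := by
      have := (ENNReal.tendsto_toReal ENNReal.zero_ne_top).comp hlim
      rwa [ENNReal.toReal_zero] at this
    refine h1.congr' ?_
    filter_upwards [hlim.eventually (gt_mem_nhds ENNReal.zero_lt_top)] with η hη
    exact (if_neg (ne_of_lt hη)).symm
  -- The event is fixed before `η`, so the conclusions hold simultaneously in `η`.
  obtain ⟨E, hE, hprob, hbal⟩ := hevent μ hμ n M hn hM hnM
  refine ⟨E, hE, by rwa [Real.rpow_one], fun xs hxs => ?_⟩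
  have hn0 : (0 : ℝ) < n := by exact_mod_cast hn
  have hn1 : (1 : ℝ) ≤ n := by exact_mod_cast hn
  have hΘ1 : Θ < 1 := hΘC.trans hC1
  obtain ⟨hYG, hGY⟩ := hest Θ hΘ hΘC n hn M hM xs μ.support (hbal xs hxs)
  set ϑ := Θ ^ (-(1 / (s - α))) with hϑ
  have hϑ1 : 1 ≤ ϑ :=
    Real.one_le_rpow_of_pos_of_le_one_of_nonpos hΘ hΘ1.le (neg_nonpos.mpr (by positivity))
  have hϑinv : ϑ * Θ ^ (1 / (s - α)) = 1 := by
    rw [hϑ, ← Real.rpow_add hΘ]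
    simp
  refine ⟨⟨hYG, hGY.trans (Metric.cthickening_mono (by gcongr; linarith) _)⟩,
    fun η hη hηη₀ hnη hSlast => ?_⟩
  have hpart := hS.partition η hη hηη₀
  have hrη : (b + 1) * ϑ / n ≤ η / 2 := by
    have hΘp : 0 < Θ ^ (1 / (s - α)) := by positivity
    rw [div_le_iff₀ (by positivity)] at hnη
    rw [div_le_iff₀ hn0]
    calc (b + 1) * ϑ = ϑ * (2 * (b + 1)) / 2 := by ring
      _ ≤ ϑ * (n * (η * Θ ^ (1 / (s - α)))) / 2 := by gcongr
      _ = (ϑ * Θ ^ (1 / (s - α))) * (η / 2 * n) := by ring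
      _ = η / 2 * n := by rw [hϑinv, one_mul]
  have hball : ∀ y ∈ μ.support, μ.real (S η (Fin.last (K η))) <
      μ.real (Metric.closedBall y (1 / (n : ℝ))) := by
    intro y hy
    have h1 := hμ.lower_of_le_one hy (r := 1 / (n : ℝ)) (by positivity)
      ((div_le_one hn0).mpr hn1)
    rw [one_div, Real.inv_rpow hn0.le, ← Real.rpow_neg hn0.le, ← one_div] at h1
    refine hSlast.trans_lt (lt_of_lt_of_le ?_ h1)
    have hκm : 0 < κ₂ * (min r₀ 1) ^ α := by positivity
    -- Strictness comes from `Θ < 1`.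
    exact mul_lt_mul_of_pos_right (mul_lt_of_lt_one_right hκm hΘ1) (by positivity)
  have hpieces := SupportEstimation.estimationPiece_isPartition (h := h) (xs := xs) (Θ := Θ)
    (R := b * ϑ) (r := (b + 1) * ϑ) hn hpart.1 (hS.separation η hη hηη₀) hη (by positivity)
    (by linarith) hrη hGY hball
  refine ⟨hpieces, ?_⟩
  have hCm : ∀ k : Fin (K η), MeasurableSet
      (SupportEstimation.estimationPiece h n xs Θ ((b + 1) * ϑ) (S η k.castSucc)) := fun k =>
    (SupportEstimation.isClosed_estimationPiece h n xs Θ _ _).measurableSet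
  have hSY : ∀ i, S η i ⊆ μ.support := fun i => hpart.1 ▸ subset_iUnion (S η) i
  have hfull : μ.real (⋃ k : Fin (K η),
      SupportEstimation.estimationPiece h n xs Θ ((b + 1) * ϑ) (S η k.castSucc)) = 1 := by
    rw [hpieces.1.1, measureReal_def, ENNReal.toReal_eq_one_iff, ← prob_compl_eq_zero_iff₀]
    · exact measure_mono_null (compl_subset_compl.mpr hYG) Measure.measure_compl_support
    · rw [← hpieces.1.1]
      exact (MeasurableSet.iUnion hCm).nullMeasurableSet
  beta_reduce
  by_cases htop : Q η = ⊤
  · rw [if_pos htop]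
    exact SupportEstimation.abs_fScore_sub_one_le_one hCm hpieces.1.2 hfull _
  · rw [if_neg htop]
    refine SupportEstimation.abs_fScore_sub_one_le hCm hpieces.1.2 hfull
      (fun k x hx => ⟨hYG (hSY _ hx), Metric.self_subset_cthickening _ hx⟩)
      (m := μ.real (S η (Fin.last (K η)))) ENNReal.toReal_nonneg ?_ fun k => ?_
    · have hsub : (⋃ k : Fin (K η), S η k.castSucc)ᶜ ⊆
          S η (Fin.last (K η)) ∪ μ.supportᶜ := by
        intro x hx
        by_cases hxs' : x ∈ μ.support
        · rw [← hpart.1] at hxs'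
          obtain ⟨i, hi⟩ := mem_iUnion.mp hxs'
          induction i using Fin.lastCases with
          | last => exact Or.inl hi
          | cast k => exact absurd (mem_iUnion.mpr ⟨k, hi⟩) hx
        · exact Or.inr hxs'
      refine ((measureReal_mono hsub).trans (measureReal_union_le _ _)).trans (le_of_eq ?_)
      simp [measureReal_def]
    · have h1 : μ (S η (Fin.last (K η))) / μ (S η k.castSucc) ≤ Q η :=
        le_iSup (fun k : Fin (K η) => μ (S η (Fin.last (K η))) / μ (S η k.castSucc)) k
      -- A null main piece is harmless: a finite ratio then forces the exceptional mass to vanish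
      -- too.
      rw [ENNReal.div_le_iff_le_mul (Or.inr htop) (Or.inl (measure_ne_top _ _))] at h1
      rw [measureReal_def, measureReal_def, ← ENNReal.toReal_mul]
      exact ENNReal.toReal_mono (ENNReal.mul_ne_top htop (measure_ne_top _ _)) h1
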